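/- Consider two-player zero-sum Markov games with horizon $H\ge 1$, a measurable state space $\mathcal S$, finite nonempty action sets $\mathcal A_1,\mathcal A_2$, deterministic rewards $r_h\in[0,1]$ and transition kernels $\mathbb P_h$, $h\in[H]$, in which every episode starts from a fixed state $x$. Assume the game is linear: there are a known measurable feature map $\phi:\mathcal S\times\mathcal A_1\times\mathcal A_2\to\mathbb R^d$ ($d\ge1$), vectors $\theta_h\in\mathbb R^d$ and vectors $\mu_h=(\mu_h^{(1)},\dots,\mu_h^{(d)})$ of signed measures on $\mathcal S$ such that $r_h(s,a,b)=\phi(s,a,b)^\top\theta_h$, $\mathbb P_h(\cdot\mid s,a,b)=\phi(s,a,b)^\top\mu_h(\cdot)$, $\|\phi(s,a,b)\|\le 1$, $\|\theta_h\|\le\sqrt d$, $\|\mu_h(\mathcal S)\|\le\sqrt d$ (Euclidean norms). For Markov policies $\pi=(\pi_h)$, $\nu=(\nu_h)$ of the max- and the min-player let $V_1^{\pi,\nu}(x)=\mathbb E_{\pi,\nu}[\sum_{h=1}^H r_h(s_h,a_h,b_h)\mid s_1=x]$, and define the duality gap $\mathrm{SubOpt}((\pi,\nu),x)=\sup_{\pi'}V_1^{\pi',\nu}(x)-\inf_{\nu'}V_1^{\pi,\nu'}(x)$.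 Given a dataset $\mathcal D=\{(s_h^\tau,a_h^\tau,b_h^\tau,r_h^\tau)\}_{\tau\in[K],h\in[H]}$ and $\beta>0$, pessimistic minimax value iteration (PMVI) sets $\underline V_{H+1}=\overline V_{H+1}=0$ and, for $h=H,\dots,1$, with $\phi_h^\tau=\phi(s_h^\tau,a_h^\tau,b_h^\tau)$, $\Lambda_h=I+\sum_\tau\phi_h^\tau(\phi_h^\tau)^\top$, $\Pi_m(y)=\min\{m,\max\{y,0\}\}$, $\Gamma_h=\beta\sqrt{\phi^\top\Lambda_h^{-1}\phi}$, $$\underline w_h=\Lambda_h^{-1}\sum_\tau\phi_h^\tau\big(r_h^\tau+\underline V_{h+1}(s_{h+1}^\tau)\big),\qquad \overline w_h=\Lambda_h^{-1}\sum_\tau\phi_h^\tau\big(r_h^\tau+\overline V_{h+1}(s_{h+1}^\tau)\big),$$ $$\underline Q_h=\Pi_{H-h+1}(\phi^\top\underline w_h-\Gamma_h),\qquad \overline Q_h=\Pi_{H-h+1}(\phi^\top\overline w_h+\Gamma_h).$$ For every state $s$ it lets $(\hat\pi_h(\cdot|s),\nu'_h(\cdot|s))$ and $(\pi'_h(\cdot|s),\hat\nu_h(\cdot|s))$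 be (mixed) Nash equilibria of the zero-sum matrix games $\underline Q_h(s,\cdot,\cdot)$ and $\overline Q_h(s,\cdot,\cdot)$, puts $\underline V_h(s)=\mathbb E_{a\sim\hat\pi_h(\cdot|s),\,b\sim\nu'_h(\cdot|s)}\underline Q_h(s,a,b)$ and $\overline V_h(s)=\mathbb E_{a\sim\pi'_h(\cdot|s),\,b\sim\hat\nu_h(\cdot|s)}\overline Q_h(s,a,b)$, and finally outputs $(\hat\pi,\hat\nu)$. There is an absolute constant $c_0>0$ such that for every $c\ge c_0$ and every $\underline c>0$ there is a constant $c'>0$, depending only on $c$ and $\underline c$, with the following property. For all $d,H\ge 1$ and $p\in(0,1)$ there is a $K_0$ (depending only on $c,\underline c,d,H,p$) such that for all $K\ge K_0$, $K\ge1$, and every game as above: suppose that $\mathcal D$ consists of $K$ independent episodes, with their rewards, induced from $x$ by a fixed pair of Markov policies $(\overline\pi,\overline\nu)$ with $$\lambda_{\min}(\Sigma_h)\ge\underline c\quad\text{for all }h\in[H],\qquad \Sigma_h=\mathbb E_{\overline\pi,\overline\nu}\big[\phi(s_h,a_h,b_h)\phi(s_h,a_h,b_h)^\top\mid s_1=x\big],$$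 and PMVI is run with $\beta=c\,d\,H\sqrt\zeta$, $\zeta=\log(4dHK/p)$. Then, with probability at least $1-p$, every pair $(\hat\pi,\hat\nu)$ that PMVI can output on $\mathcal D$ (whichever Nash equilibria it selects) satisfies $$\mathrm{SubOpt}((\hat\pi,\hat\nu),x)\le c'\,d\,H^2K^{-1/2}\sqrt\zeta .$$ -/

import Mathlib

open MeasureTheory ProbabilityTheory

namespace OfflineMG

noncomputable section

/-- A two-player zero-sum Markov game with horizon `H`, given by its reward functions and transition
kernels. Steps are numbered `0, …, H - 1`. Steps `h ≥ H` are never played, so the entries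
of `r` and `P` there are irrelevant (the same convention is used for policies). -/
structure MarkovGame (S A B : Type*) [MeasurableSpace S] [MeasurableSpace A] [MeasurableSpace B]
    (H : ℕ) where
  /-- the (deterministic) reward at step `h` -/
  r : ℕ → S × A × B → ℝ
  /-- the law of the next state after step `h` -/
  P : ℕ → Kernel (S × A × B) S
  measurable_r : ∀ h, Measurable (r h)
  r_mem : ∀ h < H, ∀ z, r h z ∈ Set.Icc (0 : ℝ) 1
  markov : ∀ h, IsMarkovKernel (P h)

/-- A Markov policy of a player with action set `A`: for every step and every state,
a probability distribution over actions. -/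
structure Policy (S A : Type*) [MeasurableSpace S] [MeasurableSpace A] where
  kernel : ℕ → Kernel S A
  markov : ∀ h, IsMarkovKernel (kernel h)

attribute [instance] MarkovGame.markov Policy.markov

section Game

variable {S A B : Type*} [MeasurableSpace S] [MeasurableSpace A] [MeasurableSpace B] {H : ℕ}

/-- The joint law of the `n` state-action triples visited at the steps `h, …, h + n - 1` when the
state at step `h` is given and the policy pair `(π, ν)` is followed: draw
`a ∼ π_h(s)` and `b ∼ ν_h(s)` independently, move to a state drawn from `P_h(s, a, b)`,
and continue from there. -/
def trajLaw (M : MarkovGame S A B H) (π : Policy S A) (ν : Policy S B) :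
    (n h : ℕ) → Kernel S (Fin n → S × A × B)
  | 0, _ => Kernel.const S (Measure.dirac Fin.elim0)
  | n + 1, h =>
    ((Kernel.id ×ₖ (π.kernel h ×ₖ ν.kernel h)) ⊗ₖ
      Kernel.prodMkLeft S (trajLaw M π ν n (h + 1) ∘ₖ M.P h)).map
        (fun p => (Fin.cons p.1 p.2 : Fin (n + 1) → S × A × B))

/-- The value function `V_h^{π,ν}(s)`: the expected total reward from step `h` on. -/
def value (M : MarkovGame S A B H) (π : Policy S A) (ν : Policy S B) (h : ℕ) (s : S) : ℝ :=
  ∫ ω, ∑ i : Fin (H - h), M.r (h + i) (ω i) ∂(trajLaw M π ν (H - h) h s)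

/-- `V_h^{π,*}(s) = inf_ν V_h^{π,ν}(s)`. -/
def valueBestMin (M : MarkovGame S A B H) (π : Policy S A) (h : ℕ) (s : S) : ℝ :=
  ⨅ ν : Policy S B, value M π ν h s

/-- `V_h^{*,ν}(s) = sup_π V_h^{π,ν}(s)`. -/
def valueBestMax (M : MarkovGame S A B H) (ν : Policy S B) (h : ℕ) (s : S) : ℝ :=
  ⨆ π : Policy S A, value M π ν h s

/-- The duality gap of a policy pair for the game started in the state `x`. -/
def dualityGap (M : MarkovGame S A B H) (π : Policy S A) (ν : Policy S B) (x : S) : ℝ :=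
  valueBestMax M ν 0 x - valueBestMin M π 0 x

/-- Linear Markov games with feature map `φ`. -/
structure IsLinear {d : ℕ} (M : MarkovGame S A B H)
    (φ : S × A × B → EuclideanSpace ℝ (Fin d)) : Prop where
  measurable_feature : Measurable φ
  norm_feature_le : ∀ z, ‖φ z‖ ≤ 1
  reward : ∃ θ : ℕ → EuclideanSpace ℝ (Fin d), ∀ h < H,
    ‖θ h‖ ≤ √(d : ℝ) ∧ ∀ z, M.r h z = inner ℝ (φ z) (θ h)
  transition : ∃ μ : ℕ → Fin d → SignedMeasure S, ∀ h < H,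
    ‖(WithLp.toLp 2 (fun i => μ h i Set.univ) : EuclideanSpace ℝ (Fin d))‖ ≤ √(d : ℝ) ∧
    ∀ z, ∀ E : Set S, MeasurableSet E → (M.P h z).real E = ∑ i, φ z i * μ h i E

/-- The feature covariance `Σ_h = E_{π,ν}[φ_h φ_hᵀ]` for episodes started in `x`. -/
def featureCov {d : ℕ} (M : MarkovGame S A B H) (φ : S × A × B → EuclideanSpace ℝ (Fin d))
    (π : Policy S A) (ν : Policy S B) (x : S) (h : Fin H) : Matrix (Fin d) (Fin d) ℝ :=
  Matrix.of fun i j => ∫ ω, φ (ω h) i * φ (ω h) j ∂(trajLaw M π ν H 0 x)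

end Game

/-- The smallest eigenvalue of a (symmetric) real matrix. -/
def lambdaMin {d : ℕ} (M : Matrix (Fin d) (Fin d) ℝ) : ℝ :=
  sInf {l : ℝ | Module.End.HasEigenvalue (Matrix.toLin' M) l}

/-- One record `(s, a, b, r)` of a dataset. -/
structure Obs (S A B : Type*) where
  s : S
  a : A
  b : B
  r : ℝ

/-- A dataset of `K` episodes of length `H`. -/
abbrev Dataset (S A B : Type*) (K H : ℕ) := Fin K → Fin H → Obs S A B

section Data

variable {S A B : Type*} [MeasurableSpace S] [MeasurableSpace A] [MeasurableSpace B]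
  {K H : ℕ}

/-- The law of `K` independent episodes, each induced by `(π, ν)` from the initial state `x`. -/
def episodesLaw (M : MarkovGame S A B H) (π : Policy S A) (ν : Policy S B) (x : S) (K : ℕ) :
    Measure (Fin K → Fin H → S × A × B) :=
  Measure.pi fun _ => trajLaw M π ν H 0 x

/-- The dataset recorded from `K` episodes: all visited triples with the rewards received. -/
def record (M : MarkovGame S A B H) (ω : Fin K → Fin H → S × A × B) : Dataset S A B K H :=
  fun τ h => ⟨(ω τ h).1, (ω τ h).2.1, (ω τ h).2.2, M.r h (ω τ h)⟩

end Data

section Algorithm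

variable {S A B : Type*} {d K H : ℕ}

/-- The truncation `Π_m(y) = min{m, max{y, 0}}`. -/
def clip (m y : ℝ) : ℝ := min m (max y 0)

/-- The feature vector `φ_h^τ` of a record. -/
def obsFeature (φ : S × A × B → EuclideanSpace ℝ (Fin d)) (o : Obs S A B) : Fin d → ℝ :=
  (φ (o.s, o.a, o.b)).ofLp

/-- `Λ_h = ∑_τ φ_h^τ (φ_h^τ)ᵀ + I`. -/
def gram (φ : S × A × B → EuclideanSpace ℝ (Fin d)) (D : Dataset S A B K H) (h : Fin H) :
    Matrix (Fin d) (Fin d) ℝ :=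
  ∑ τ, Matrix.vecMulVec (obsFeature φ (D τ h)) (obsFeature φ (D τ h)) + 1

/-- The value `V(x_{h+1}^τ)` of the state following step `h` in episode `τ`, where `V` is a value
function for step `h + 1`; it is `0` after the last step. -/
def nextValue (D : Dataset S A B K H) (V : S → ℝ) (τ : Fin K) (h : Fin H) : ℝ :=
  if hh : (h : ℕ) + 1 < H then V (D τ ⟨h + 1, hh⟩).s else 0

/-- `w_h = Λ_h⁻¹ ∑_τ φ_h^τ (r_h^τ + V(x_{h+1}^τ))`. -/
def ridge (φ : S × A × B → EuclideanSpace ℝ (Fin d)) (D : Dataset S A B K H) (V : S → ℝ)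
    (h : Fin H) : Fin d → ℝ :=
  (gram φ D h)⁻¹.mulVec (∑ τ, ((D τ h).r + nextValue D V τ h) • obsFeature φ (D τ h))

/-- The bonus `Γ_h(s, a, b) = β √(φᵀ Λ_h⁻¹ φ)`. -/
def bonus (φ : S × A × B → EuclideanSpace ℝ (Fin d)) (β : ℝ) (D : Dataset S A B K H)
    (h : Fin H) (z : S × A × B) : ℝ :=
  β * √((φ z).ofLp ⬝ᵥ (gram φ D h)⁻¹.mulVec (φ z).ofLp)

/-- The pessimistic Q-function of the max-player, built from a value function `V` for step `h + 1`.
(With steps numbered from `0`, there are `H - h` steps left at step `h`.) -/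
def lowerQ (φ : S × A × B → EuclideanSpace ℝ (Fin d)) (β : ℝ) (D : Dataset S A B K H)
    (V : S → ℝ) (h : Fin H) (s : S) (a : A) (b : B) : ℝ :=
  clip ((H : ℝ) - (h : ℕ))
    ((φ (s, a, b)).ofLp ⬝ᵥ ridge φ D V h - bonus φ β D h (s, a, b))

/-- The pessimistic Q-function of the min-player, built from a value function `V` for step `h + 1`.
-/
def upperQ (φ : S × A × B → EuclideanSpace ℝ (Fin d)) (β : ℝ) (D : Dataset S A B K H)
    (V : S → ℝ) (h : Fin H) (s : S) (a : A) (b : B) : ℝ :=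
  clip ((H : ℝ) - (h : ℕ))
    ((φ (s, a, b)).ofLp ⬝ᵥ ridge φ D V h + bonus φ β D h (s, a, b))

variable [MeasurableSpace S] [MeasurableSpace A] [MeasurableSpace B] [Fintype A] [Fintype B]

/-- The expected payoff `E_{a ∼ p, b ∼ q} G(a, b)`. -/
def payoff (G : A → B → ℝ) (p : Measure A) (q : Measure B) : ℝ :=
  ∑ a, ∑ b, p.real {a} * q.real {b} * G a b

/-- `(p, q)` is a Nash equilibrium in mixed strategies of the zero-sum matrix game with payoff
matrix `G`, whose row player maximizes and whose column player minimizes. -/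
def IsMatrixNash (G : A → B → ℝ) (p : Measure A) (q : Measure B) : Prop :=
  IsProbabilityMeasure p ∧ IsProbabilityMeasure q ∧
  (∀ p' : Measure A, IsProbabilityMeasure p' → payoff G p' q ≤ payoff G p q) ∧
  (∀ q' : Measure B, IsProbabilityMeasure q' → payoff G p q ≤ payoff G p q')

/-- `(piHat, nuHat)` is an output of pessimistic minimax value iteration with bonus parameter `β`
on the dataset `D`: some run of the algorithm, for some choice of the Nash equilibria
of the matrix games it solves, produces this pair. -/
def IsPMVIOutput (φ : S × A × B → EuclideanSpace ℝ (Fin d)) (β : ℝ) (D : Dataset S A B K H)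
    (piHat : Policy S A) (nuHat : Policy S B) : Prop :=
  ∃ (piPrime : Policy S A) (nuPrime : Policy S B) (Vlow Vup : ℕ → S → ℝ),
    (∀ s, Vlow H s = 0) ∧ (∀ s, Vup H s = 0) ∧
    ∀ (h : Fin H) (s : S),
      IsMatrixNash (lowerQ φ β D (Vlow (h + 1)) h s) (piHat.kernel h s) (nuPrime.kernel h s) ∧
      IsMatrixNash (upperQ φ β D (Vup (h + 1)) h s) (piPrime.kernel h s) (nuHat.kernel h s) ∧
      Vlow h s =
        payoff (lowerQ φ β D (Vlow (h + 1)) h s) (piHat.kernel h s) (nuPrime.kernel h s) ∧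
      Vup h s =
        payoff (upperQ φ β D (Vup (h + 1)) h s) (piPrime.kernel h s) (nuHat.kernel h s)

end Algorithm

end

end OfflineMG

open OfflineMG

namespace OfflineMG

/-! ### Integrals under the trajectory law -/

section Trajectories

/-! Good coverage makes PMVI accurate uniformly over states and actions, so the sign of the bonus is
never exploited: the bonus is charged as one more error term. Since `Σ_h ≥ cLow`, entrywise
Hoeffding gives `Λ_h ≥ κ` with `κ = K * cLow / 2`, except on an event of probability `p / 2`
(`IsLinear.measure_exists_cov_le`, `IsLinear.le_gram_of_cov`). The bonus is then at most `β / √κ`,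
which has the target order `d H √(ζ / K)`.

Linearity makes the Bellman image of any bounded measurable value function equal to `φ ⬝ᵥ w`, and
coverage bounds `w` by `H / √cLow`. The ridge error is therefore (noise + regularization bias) `/
κ`. With the bonus this gives a sup-norm error `ε` per step (`IsLinear.abs_bonusQ_sub_bellman_le`),
and backward induction turns it into a gap of at most `4 * H * ε` (`dualityGap_le`).

The difficulty is the noise: the value function at step `h + 1` is computed from the same data as
the regression at step `h`. Every equilibrium payoff equals the max-min value of its matrix game
(`IsMatrixNash.payoff_eq_gameValue`). So, whichever equilibria are selected, the value functions lie
in a family with `d + d * d` real parameters, a weight `w` and a matrix `L`. For fixed parameters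
and a fixed direction `u`, the noise is a sum of i.i.d. centered bounded terms, one per episode.
Hoeffding and a union bound over a grid for `(u, w, L)` control it
(`IsLinear.measure_exists_noise_le`), and rounding extends the bound to all parameters
(`sqrt_noiseVec_le`). The grid has at most `K ^ 9` points per coordinate, so noise of order `d H √(K
ζ)` suffices. -/

theorem integrable_of_abs_le {X : Type*} [MeasurableSpace X] {μ : Measure X} [IsFiniteMeasure μ]
    {f : X → ℝ} (hf : Measurable f) {C : ℝ} (hC : ∀ x, |f x| ≤ C) : Integrable f μ :=
  Integrable.of_bound hf.aestronglyMeasurable C (ae_of_all _ hC)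

theorem abs_integral_le_of_abs_le {X : Type*} [MeasurableSpace X] {μ : Measure X}
    [IsProbabilityMeasure μ] {f : X → ℝ} {C : ℝ} (hC : ∀ x, |f x| ≤ C) :
    |∫ x, f x ∂μ| ≤ C := by
  simpa using norm_integral_le_of_norm_le_const (μ := μ) (f := f) (C := C) (ae_of_all _ hC)

theorem measurable_finCons {Z : Type*} [MeasurableSpace Z] (n : ℕ) :
    Measurable (fun p : Z × (Fin n → Z) => (Fin.cons p.1 p.2 : Fin (n + 1) → Z)) := by
  refine measurable_pi_iff.2 fun i => ?_
  refine Fin.cases ?_ (fun j => ?_) i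
  · simpa using measurable_fst
  · simp only [Fin.cons_succ]
    fun_prop

variable {S A B : Type*} [MeasurableSpace S] [MeasurableSpace A] [MeasurableSpace B] {H : ℕ}
  (M : MarkovGame S A B H) (π : Policy S A) (ν : Policy S B)

instance isMarkovKernel_trajLaw : ∀ n h : ℕ, IsMarkovKernel (trajLaw M π ν n h)
  | 0, _ => by unfold trajLaw; infer_instance
  | n + 1, h => by
    have := isMarkovKernel_trajLaw n (h + 1)
    unfold trajLaw
    exact Kernel.IsMarkovKernel.map _ (measurable_finCons n)

/-- The law of the triple `(s, a, b)` played in the state `s` at step `h`. -/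
noncomputable def stepLaw (h : ℕ) : Kernel S (S × A × B) :=
  Kernel.id ×ₖ (π.kernel h ×ₖ ν.kernel h)

instance (h : ℕ) : IsMarkovKernel (stepLaw π ν h) := by unfold stepLaw; infer_instance

theorem measurable_kernel_integral {X Y : Type*} [MeasurableSpace X] [MeasurableSpace Y]
    (κ : Kernel X Y) [IsMarkovKernel κ] {f : Y → ℝ} (hf : Measurable f) :
    Measurable fun x => ∫ y, f y ∂κ x :=
  (StronglyMeasurable.integral_kernel hf.stronglyMeasurable).measurable

/-- Peels off the first step of a trajectory; every later fact about `trajLaw` is an induction on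
this identity. -/
theorem integral_trajLaw_succ (n h : ℕ) (s : S) {F : (Fin (n + 1) → S × A × B) → ℝ}
    (hF : Measurable F) {C : ℝ} (hC : ∀ ω, |F ω| ≤ C) :
    ∫ ω, F ω ∂trajLaw M π ν (n + 1) h s =
      ∫ z, ∫ s', ∫ ω, F (Fin.cons z ω) ∂trajLaw M π ν n (h + 1) s' ∂M.P h z ∂stepLaw π ν h s := by
  have hF' : Measurable fun p : (S × A × B) × (Fin n → S × A × B) =>
      F (Fin.cons p.1 p.2 : Fin (n + 1) → S × A × B) := hF.comp (measurable_finCons n)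
  have e : trajLaw M π ν (n + 1) h =
    (stepLaw π ν h ⊗ₖ Kernel.prodMkLeft S (trajLaw M π ν n (h + 1) ∘ₖ M.P h)).map
        (fun p => (Fin.cons p.1 p.2 : Fin (n + 1) → S × A × B)) := rfl
  rw [e, Kernel.map_apply _ (measurable_finCons n),
    integral_map (measurable_finCons n).aemeasurable hF.aestronglyMeasurable,
    ProbabilityTheory.integral_compProd (integrable_of_abs_le hF' fun _ => hC _)]
  refine integral_congr_ae (ae_of_all _ fun z => ?_)
  have hz : Measurable fun ω => F (Fin.cons z ω : Fin (n + 1) → S × A × B) :=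
    hF'.comp measurable_prodMk_left
  simp only [Kernel.prodMkLeft_apply]
  exact Kernel.integral_comp (integrable_of_abs_le hz fun _ => hC _)

variable [Fintype A] [MeasurableSingletonClass A] [Fintype B] [MeasurableSingletonClass B]

theorem integral_stepLaw (h : ℕ) (s : S) {G : S × A × B → ℝ} (hG : Measurable G) {C : ℝ}
    (hC : ∀ z, |G z| ≤ C) :
    ∫ z, G z ∂stepLaw π ν h s =
      payoff (fun a b => G (s, a, b)) (π.kernel h s) (ν.kernel h s) := by
  have hs : Measurable fun y : A × B => G (s, y) := hG.comp measurable_prodMk_left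
  have hm : Measurable fun x : S => ∫ y : A × B, G (x, y) ∂(π.kernel h s).prod (ν.kernel h s) :=
    (hG.stronglyMeasurable.integral_prod_right').measurable
  rw [stepLaw, Kernel.prod_apply, Kernel.id_apply, Kernel.prod_apply,
    integral_prod _ (integrable_of_abs_le hG hC), integral_dirac' _ _ hm.stronglyMeasurable,
    integral_prod _ (integrable_of_abs_le hs fun _ => hC _), integral_fintype .of_finite]
  refine Finset.sum_congr rfl fun a _ => ?_
  rw [integral_fintype .of_finite, smul_eq_mul, Finset.mul_sum]
  refine Finset.sum_congr rfl fun b _ => ?_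
  rw [smul_eq_mul, mul_assoc]

theorem payoff_const (p : Measure A) (q : Measure B) [IsProbabilityMeasure p]
    [IsProbabilityMeasure q] (c : ℝ) : payoff (fun _ _ => c) p q = c := by
  have hp : ∑ a, p.real {a} = 1 := by simp
  have hq : ∑ b, q.real {b} = 1 := by simp
  simp only [payoff, ← Finset.sum_mul, ← Finset.mul_sum, hp, hq, one_mul]

theorem integral_trajLaw_head (n h : ℕ) (s : S) {f : S → ℝ} (hf : Measurable f) {C : ℝ}
    (hC : ∀ s, |f s| ≤ C) :
    ∫ ω, f (ω 0).1 ∂trajLaw M π ν (n + 1) h s = f s := by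
  rw [integral_trajLaw_succ M π ν n h s (F := fun ω => f (ω 0).1) (by fun_prop) fun _ => hC _]
  simp only [Fin.cons_zero, integral_const, probReal_univ, one_smul]
  rw [integral_stepLaw π ν h s (G := fun z => f z.1) (by fun_prop) fun _ => hC _]
  exact payoff_const (π.kernel h s) (ν.kernel h s) (f s)

/-- Conditionally on the triple visited at step `i`, the next state is drawn from the transition
kernel. -/
theorem integral_trajLaw_transition {f : S → ℝ} (hf : Measurable f) {Cf : ℝ}
    (hCf : ∀ s, |f s| ≤ Cf) {g : S × A × B → ℝ} (hg : Measurable g) {Cg : ℝ}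
    (hCg : ∀ z, |g z| ≤ Cg) (i : ℕ) : ∀ (n h : ℕ) (s : S) (hi : i + 1 < n),
    ∫ ω, g (ω ⟨i, by omega⟩) * (f (ω ⟨i + 1, hi⟩).1 - ∫ s', f s' ∂M.P (h + i) (ω ⟨i, by omega⟩))
      ∂trajLaw M π ν n h s = 0 := by
  have hP : ∀ k, Measurable fun z => ∫ s', f s' ∂M.P k z :=
    fun k => measurable_kernel_integral (M.P k) hf
  have hbd : ∀ k s z z', |g z' * (f s - ∫ s', f s' ∂M.P k z)| ≤ Cg * (Cf + Cf) := fun k s z z' => by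
    rw [abs_mul]
    exact mul_le_mul (hCg _) ((abs_sub _ _).trans (add_le_add (hCf _)
      (abs_integral_le_of_abs_le hCf))) (abs_nonneg _) ((abs_nonneg _).trans (hCg z))
  induction i with
  | zero =>
    intro n h s hi
    obtain ⟨n, rfl⟩ : ∃ m, n = m + 1 + 1 := ⟨n - 2, by omega⟩
    have hm : Measurable fun ω : Fin (n + 1 + 1) → S × A × B => g (ω ⟨0, by omega⟩) *
        (f (ω ⟨0 + 1, hi⟩).1 - ∫ s', f s' ∂M.P (h + 0) (ω ⟨0, by omega⟩)) :=
      (hg.comp (measurable_pi_apply _)).mul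
        ((hf.comp (measurable_fst.comp (measurable_pi_apply _))).sub
          ((hP _).comp (measurable_pi_apply _)))
    rw [integral_trajLaw_succ M π ν (n + 1) h s hm fun ω => hbd _ _ _ _]
    have h0 : ∀ (z : S × A × B) (ω : Fin (n + 1) → S × A × B),
        (Fin.cons z ω : Fin (n + 1 + 1) → S × A × B) ⟨0, by omega⟩ = z := fun _ _ => rfl
    have h1 : ∀ (z : S × A × B) (ω : Fin (n + 1) → S × A × B),
        (Fin.cons z ω : Fin (n + 1 + 1) → S × A × B) ⟨0 + 1, hi⟩ = ω 0 := fun _ _ => rfl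
    simp only [h0, h1, add_zero]
    refine integral_eq_zero_of_ae (ae_of_all _ fun z => ?_)
    -- Once the first triple is fixed, `g z` and the conditional mean are constants, and the next
    -- state is the head of the remaining trajectory, which starts at `s'`.
    have hin : ∀ s', ∫ ω : Fin (n + 1) → S × A × B, g z * (f (ω 0).1 - ∫ s', f s' ∂M.P h z)
        ∂trajLaw M π ν (n + 1) (h + 1) s' = g z * (f s' - ∫ s', f s' ∂M.P h z) := by
      intro s'
      rw [integral_const_mul, integral_sub _ (integrable_const _),
        integral_trajLaw_head M π ν n (h + 1) s' hf hCf]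
      · simp
      · exact integrable_of_abs_le (hf.comp (measurable_fst.comp (measurable_pi_apply _)))
          fun _ => hCf _
    simp only [hin]
    rw [integral_const_mul, integral_sub (integrable_of_abs_le hf hCf) (integrable_const _)]
    simp
  | succ i ih =>
    intro n h s hi
    obtain ⟨n, rfl⟩ : ∃ m, n = m + 1 := ⟨n - 1, by omega⟩
    have hm : Measurable fun ω : Fin (n + 1) → S × A × B => g (ω ⟨i + 1, by omega⟩) *
        (f (ω ⟨i + 1 + 1, hi⟩).1 - ∫ s', f s' ∂M.P (h + (i + 1)) (ω ⟨i + 1, by omega⟩)) :=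
      (hg.comp (measurable_pi_apply _)).mul
        ((hf.comp (measurable_fst.comp (measurable_pi_apply _))).sub
          ((hP _).comp (measurable_pi_apply _)))
    rw [integral_trajLaw_succ M π ν n h s hm fun ω => hbd _ _ _ _]
    refine integral_eq_zero_of_ae (ae_of_all _ fun z => ?_)
    refine integral_eq_zero_of_ae (ae_of_all _ fun s' => ?_)
    -- Removing the first triple shifts the index down and the starting step up, so `h + i` is the
    -- same absolute step.
    have := ih n (h + 1) s' (by omega)
    rw [show h + 1 + i = h + (i + 1) by omega] at this
    exact this

end Trajectories

/-! ### Value functions and the Bellman equation -/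

section Bellman

variable {S A B : Type*} [MeasurableSpace S] [MeasurableSpace A] [MeasurableSpace B] {H : ℕ}
  (M : MarkovGame S A B H) (π : Policy S A) (ν : Policy S B)

theorem abs_sum_reward_le (n h : ℕ) (hn : h + n ≤ H) (ω : Fin n → S × A × B) :
    |∑ i : Fin n, M.r (h + i) (ω i)| ≤ n := by
  refine (Finset.abs_sum_le_sum_abs _ _).trans ?_
  refine (Finset.sum_le_sum (g := fun _ => (1 : ℝ)) fun i _ => ?_).trans (by simp)
  have := M.r_mem (h + i) (by omega) (ω i)
  exact abs_le.2 ⟨by linarith [this.1], this.2⟩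

theorem measurable_sum_reward (n h : ℕ) :
    Measurable fun ω : Fin n → S × A × B => ∑ i : Fin n, M.r (h + i) (ω i) :=
  Finset.measurable_sum _ fun i _ => (M.measurable_r _).comp (measurable_pi_apply i)

theorem measurable_value (h : ℕ) : Measurable (value M π ν h) :=
  measurable_kernel_integral _ (measurable_sum_reward M _ _)

theorem abs_value_le {h : ℕ} (hh : h ≤ H) (s : S) : |value M π ν h s| ≤ (H - h : ℕ) :=
  abs_integral_le_of_abs_le (abs_sum_reward_le M _ _ (by omega))

theorem value_horizon (s : S) : value M π ν H s = 0 := by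
  -- The trajectory length `H - H` occurs in a type, so it is generalized before being replaced by
  -- `0`.
  have h0 : ∀ n h, n = 0 →
      ∫ ω : Fin n → S × A × B, ∑ i : Fin n, M.r (h + i) (ω i) ∂(trajLaw M π ν n h s) = 0 := by
    rintro _ h rfl
    simp
  exact h0 _ _ (by omega)

variable [Fintype A] [MeasurableSingletonClass A] [Fintype B] [MeasurableSingletonClass B]

/-- The Bellman equation. -/
theorem value_eq_payoff {h : ℕ} (hh : h < H) (s : S) :
    value M π ν h s =
      payoff (fun a b => M.r h (s, a, b) + ∫ s', value M π ν (h + 1) s' ∂M.P h (s, a, b))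
        (π.kernel h s) (ν.kernel h s) := by
  obtain ⟨n, hn⟩ : ∃ n, H - h = n + 1 := ⟨H - h - 1, by omega⟩
  have hn' : H - (h + 1) = n := by omega
  have e0 : value M π ν h s =
      ∫ ω, ∑ i : Fin (n + 1), M.r (h + i) (ω i) ∂(trajLaw M π ν (n + 1) h s) := by
    unfold value; rw [hn]
  have e1 : ∀ s', value M π ν (h + 1) s' =
      ∫ ω, ∑ i : Fin n, M.r (h + 1 + i) (ω i) ∂(trajLaw M π ν n (h + 1) s') := by
    intro s'; unfold value; rw [hn']
  have hb := abs_sum_reward_le M n (h + 1) (by omega)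
  have hm := measurable_sum_reward M n (h + 1)
  have hr : ∀ z, |M.r h z| ≤ 1 := fun z =>
    abs_le.2 ⟨by linarith [(M.r_mem h hh z).1], (M.r_mem h hh z).2⟩
  have hvb := abs_value_le M π ν (h := h + 1) (by omega)
  have key : ∀ z, ∫ s', ∫ ω : Fin n → S × A × B, ∑ i : Fin (n + 1),
      M.r (h + i) ((Fin.cons z ω : Fin (n + 1) → S × A × B) i)
        ∂trajLaw M π ν n (h + 1) s' ∂M.P h z =
      M.r h z + ∫ s', value M π ν (h + 1) s' ∂M.P h z := by
    intro z
    have : ∀ s', ∫ ω : Fin n → S × A × B, ∑ i : Fin (n + 1),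
        M.r (h + i) ((Fin.cons z ω : Fin (n + 1) → S × A × B) i)
        ∂trajLaw M π ν n (h + 1) s' = M.r h z + value M π ν (h + 1) s' := by
      intro s'
      simp only [Fin.sum_univ_succ, Fin.cons_zero, Fin.cons_succ, Fin.val_zero, add_zero,
        Fin.val_succ]
      rw [integral_add (integrable_const _), e1]
      · simp only [integral_const, probReal_univ, one_smul]
        simp only [add_assoc, add_comm 1]
      · have := integrable_of_abs_le (μ := trajLaw M π ν n (h + 1) s') hm hb
        simpa only [add_assoc, add_comm 1] using this
    simp only [this]
    rw [integral_add (integrable_const _)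
      (integrable_of_abs_le (measurable_value M π ν _) hvb)]
    simp
  rw [e0, integral_trajLaw_succ M π ν n h s (measurable_sum_reward M (n + 1) h)
    (abs_sum_reward_le M (n + 1) h (by omega))]
  simp only [key]
  refine integral_stepLaw π ν h s (G := fun z => M.r h z + ∫ s', value M π ν (h + 1) s' ∂M.P h z)
    ((M.measurable_r h).add (measurable_kernel_integral _ (measurable_value M π ν _)))
    (C := 1 + (H - (h + 1) : ℕ)) fun z => ?_
  exact (abs_add_le _ _).trans (add_le_add (hr z) (abs_integral_le_of_abs_le hvb))

end Bellman

/-! ### Zero-sum matrix games and their values -/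

section MatrixGame

theorem exists_abs_le_of_finite {A B : Type*} [Fintype A] [Fintype B]
    (G : A → B → ℝ) : ∃ C, ∀ a b, |G a b| ≤ C := by
  refine ⟨∑ a, ∑ b, |G a b|, fun a b => ?_⟩
  exact (Finset.single_le_sum (f := fun b => |G a b|) (fun b _ => abs_nonneg _)
    (Finset.mem_univ b)).trans (Finset.single_le_sum (f := fun a => ∑ b, |G a b|)
    (fun a _ => Finset.sum_nonneg fun b _ => abs_nonneg _) (Finset.mem_univ a))

variable {A B : Type*} [MeasurableSpace A] [MeasurableSpace B] [Fintype A] [Fintype B]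

theorem payoff_mono {G G' : A → B → ℝ} (p : Measure A) (q : Measure B)
    (h : ∀ a b, G a b ≤ G' a b) : payoff G p q ≤ payoff G' p q :=
  Finset.sum_le_sum fun a _ => Finset.sum_le_sum fun b _ =>
    mul_le_mul_of_nonneg_left (h a b) (mul_nonneg measureReal_nonneg measureReal_nonneg)

theorem payoff_add (G G' : A → B → ℝ) (p : Measure A) (q : Measure B) :
    payoff (fun a b => G a b + G' a b) p q = payoff G p q + payoff G' p q := by
  simp only [payoff, mul_add, Finset.sum_add_distrib]

/-- The value of a matrix game for the row player. -/
noncomputable def gameValue (G : A → B → ℝ) : ℝ :=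
  ⨆ p : {p : Measure A // IsProbabilityMeasure p},
    ⨅ q : {q : Measure B // IsProbabilityMeasure q}, payoff G p.1 q.1

variable [MeasurableSingletonClass A] [MeasurableSingletonClass B]

theorem payoff_le_add {G G' : A → B → ℝ} (p : Measure A) (q : Measure B) [IsProbabilityMeasure p]
    [IsProbabilityMeasure q] {ε : ℝ} (h : ∀ a b, G a b ≤ G' a b + ε) :
    payoff G p q ≤ payoff G' p q + ε :=
  (payoff_mono p q h).trans_eq (by rw [payoff_add, payoff_const])

theorem payoff_le_const {G : A → B → ℝ} (p : Measure A) (q : Measure B) [IsProbabilityMeasure p]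
    [IsProbabilityMeasure q] {C : ℝ} (h : ∀ a b, G a b ≤ C) : payoff G p q ≤ C :=
  (payoff_mono p q h).trans_eq (payoff_const p q C)

theorem const_le_payoff {G : A → B → ℝ} (p : Measure A) (q : Measure B) [IsProbabilityMeasure p]
    [IsProbabilityMeasure q] {C : ℝ} (h : ∀ a b, C ≤ G a b) : C ≤ payoff G p q :=
  (payoff_const p q C).symm.trans_le (payoff_mono p q h)

theorem bddBelow_payoff (G : A → B → ℝ) (p : Measure A) [IsProbabilityMeasure p] :
    BddBelow (Set.range fun q : {q : Measure B // IsProbabilityMeasure q} =>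
      payoff G p q.1) := by
  obtain ⟨C, hC⟩ := exists_abs_le_of_finite G
  refine ⟨-C, ?_⟩
  rintro _ ⟨⟨q, hq⟩, rfl⟩
  exact const_le_payoff p q fun a b => (abs_le.1 (hC a b)).1

theorem nonempty_probabilityMeasure (X : Type*) [MeasurableSpace X] [Nonempty X] :
    Nonempty {q : Measure X // IsProbabilityMeasure q} :=
  ⟨⟨Measure.dirac (Classical.arbitrary X), inferInstance⟩⟩

theorem bddAbove_iInf_payoff [Nonempty B] (G : A → B → ℝ) :
    BddAbove (Set.range fun p : {p : Measure A // IsProbabilityMeasure p} =>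
      ⨅ q : {q : Measure B // IsProbabilityMeasure q}, payoff G p.1 q.1) := by
  obtain ⟨C, hC⟩ := exists_abs_le_of_finite G
  obtain ⟨q⟩ := nonempty_probabilityMeasure B
  refine ⟨C, Set.forall_mem_range.2 fun p => ?_⟩
  have hp := p.2
  have hq := q.2
  have h1 : (⨅ q : {q : Measure B // IsProbabilityMeasure q}, payoff G p.1 q.1) ≤
    payoff G p.1 q.1 := ciInf_le (bddBelow_payoff G p.1) q
  have h2 : payoff G p.1 q.1 ≤ C := payoff_le_const p.1 q.1 fun a b => (abs_le.1 (hC a b)).2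
  exact h1.trans h2

/-- A saddle point attains the max-min, so no minimax theorem is needed. This removes the dependence
of the value functions on the selected equilibria. -/
theorem IsMatrixNash.payoff_eq_gameValue [Nonempty A] [Nonempty B] {G : A → B → ℝ} {p : Measure A}
    {q : Measure B} (h : IsMatrixNash G p q) : payoff G p q = gameValue G := by
  obtain ⟨hp, hq, h1, h2⟩ := h
  have := nonempty_probabilityMeasure A
  have := nonempty_probabilityMeasure B
  refine le_antisymm ?_ (ciSup_le fun p' => ?_)
  · have h3 : payoff G p q ≤
        ⨅ q : {q : Measure B // IsProbabilityMeasure q}, payoff G p q.1 :=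
      le_ciInf fun q' => h2 q'.1 q'.2
    exact h3.trans (le_ciSup (bddAbove_iInf_payoff G) ⟨p, hp⟩)
  · have := p'.2
    have h3 : (⨅ q : {q : Measure B // IsProbabilityMeasure q}, payoff G p'.1 q.1) ≤
      payoff G p'.1 q := ciInf_le (bddBelow_payoff G p'.1) ⟨q, hq⟩
    exact h3.trans (h1 p'.1 p'.2)

theorem gameValue_le_add [Nonempty A] [Nonempty B] {G G' : A → B → ℝ} {ε : ℝ}
    (h : ∀ a b, G a b ≤ G' a b + ε) : gameValue G ≤ gameValue G' + ε := by
  have := nonempty_probabilityMeasure A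
  have := nonempty_probabilityMeasure B
  refine ciSup_le fun p => ?_
  have := p.2
  rw [← sub_le_iff_le_add]
  refine le_trans ?_ (le_ciSup (bddAbove_iInf_payoff G') p)
  refine le_ciInf fun q => ?_
  have := q.2
  rw [sub_le_iff_le_add]
  exact (ciInf_le (bddBelow_payoff G p.1) q).trans (payoff_le_add p.1 q.1 h)

theorem abs_gameValue_sub_le [Nonempty A] [Nonempty B] {G G' : A → B → ℝ} {ε : ℝ}
    (h : ∀ a b, |G a b - G' a b| ≤ ε) : |gameValue G - gameValue G'| ≤ ε := by
  refine abs_sub_le_iff.2 ⟨?_, ?_⟩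
  · have := gameValue_le_add (G := G) (G' := G') (ε := ε) fun a b => by
      linarith [(abs_sub_le_iff.1 (h a b)).1]
    linarith
  · have := gameValue_le_add (G := G') (G' := G) (ε := ε) fun a b => by
      linarith [(abs_sub_le_iff.1 (h a b)).2]
    linarith

theorem gameValue_mem_Icc [Nonempty A] [Nonempty B] {G : A → B → ℝ} {m : ℝ}
    (h : ∀ a b, G a b ∈ Set.Icc 0 m) : gameValue G ∈ Set.Icc 0 m := by
  have := nonempty_probabilityMeasure A
  have := nonempty_probabilityMeasure B
  constructor
  · obtain ⟨p⟩ := nonempty_probabilityMeasure A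
    refine le_trans ?_ (le_ciSup (bddAbove_iInf_payoff G) p)
    refine le_ciInf fun q => ?_
    have := p.2
    have := q.2
    exact const_le_payoff p.1 q.1 fun a b => (h a b).1
  · refine ciSup_le fun p => ?_
    obtain ⟨q⟩ := nonempty_probabilityMeasure B
    have := p.2
    have := q.2
    exact (ciInf_le (bddBelow_payoff G p.1) q).trans (payoff_le_const p.1 q.1 fun a b => (h a b).2)

theorem lipschitzWith_gameValue [Nonempty A] [Nonempty B] :
    LipschitzWith 1 (gameValue : (A → B → ℝ) → ℝ) :=
  LipschitzWith.of_le_add fun G G' => gameValue_le_add fun a b => by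
    have := (Real.dist_eq (G a b) (G' a b)).symm.le.trans
      ((dist_le_pi_dist (G a) (G' a) b).trans (dist_le_pi_dist G G' a))
    linarith [le_abs_self (G a b - G' a b)]

/-- The value is 1-Lipschitz in the payoff matrix, hence measurable in the state, with no measurable
selection argument. -/
theorem measurable_gameValue [Nonempty A] [Nonempty B] {S : Type*} [MeasurableSpace S]
    {G : S → A → B → ℝ} (hG : ∀ a b, Measurable fun s => G s a b) :
    Measurable fun s => gameValue (G s) :=
  lipschitzWith_gameValue.continuous.measurable.comp
    (measurable_pi_iff.2 fun a => measurable_pi_iff.2 fun b => hG a b)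

end MatrixGame

/-! ### Propagation of Bellman errors to the duality gap -/

section DualityGap

variable {S A B : Type*} [MeasurableSpace S] [MeasurableSpace A] [MeasurableSpace B] {H : ℕ}
  (M : MarkovGame S A B H)

/-- The Bellman operator applied to a value function for step `h + 1`. -/
noncomputable def bellman (h : ℕ) (V : S → ℝ) (z : S × A × B) : ℝ :=
  M.r h z + ∫ s', V s' ∂M.P h z

theorem bellman_le_add {h : ℕ} {V W : S → ℝ} (hV : Measurable V) (hW : Measurable W) {C D : ℝ}
    (hC : ∀ s, |V s| ≤ C) (hD : ∀ s, |W s| ≤ D) {δ : ℝ} (hVW : ∀ s, V s ≤ W s + δ)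
    (z : S × A × B) : bellman M h V z ≤ bellman M h W z + δ := by
  have : ∫ s', V s' ∂M.P h z ≤ ∫ s', (W s' + δ) ∂M.P h z :=
    integral_mono (integrable_of_abs_le hV hC)
      ((integrable_of_abs_le hW hD).add (integrable_const _)) hVW
  rw [integral_add (integrable_of_abs_le hW hD) (integrable_const _)] at this
  simp only [integral_const, probReal_univ, one_smul] at this
  unfold bellman
  linarith

variable [Fintype A] [MeasurableSingletonClass A] [Fintype B] [MeasurableSingletonClass B]
  {M} {ε : ℝ} {π π' : Policy S A} {ν ν' : Policy S B} {V W : ℕ → S → ℝ}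
  {Q R : ℕ → S → A → B → ℝ} {C : ℝ}

/-- Replacing the equilibrium column strategy by that of an arbitrary `ν` can only raise the payoff;
each step then costs one Bellman error `ε`. -/
theorem le_value_of_nash (hV : ∀ h ≤ H, Measurable (V h)) (hC : ∀ h ≤ H, ∀ s, |V h s| ≤ C)
    (hVH : ∀ s, V H s = 0)
    (hNash : ∀ h < H, ∀ s, IsMatrixNash (Q h s) (π.kernel h s) (ν'.kernel h s) ∧
      V h s = payoff (Q h s) (π.kernel h s) (ν'.kernel h s))
    (hQ : ∀ h < H, ∀ s a b, |Q h s a b - bellman M h (V (h + 1)) (s, a, b)| ≤ ε) :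
    ∀ k h, h + k = H → ∀ s, V h s ≤ value M π ν h s + k * ε := by
  intro k
  induction k with
  | zero =>
    intro h hh s
    obtain rfl : h = H := hh
    simp [value_horizon, hVH]
  | succ k ih =>
    intro h hh s
    obtain ⟨hN, e⟩ := hNash h (by omega) s
    rw [e, value_eq_payoff M π ν (by omega)]
    refine (hN.2.2.2 (ν.kernel h s) inferInstance).trans (payoff_le_add _ _ fun a b => ?_)
    have h1 := (abs_le.1 (hQ h (by omega) s a b)).2
    have h2 := bellman_le_add M (h := h) (hV (h + 1) (by omega)) (measurable_value M π ν (h + 1))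
      (hC (h + 1) (by omega)) (abs_value_le M π ν (h := h + 1) (by omega))
      (ih (h + 1) (by omega)) (s, a, b)
    have e2 : bellman M h (value M π ν (h + 1)) (s, a, b) =
      M.r h (s, a, b) + ∫ s', value M π ν (h + 1) s' ∂M.P h (s, a, b) := rfl
    rw [← e2]
    push_cast
    linarith

theorem value_le_of_nash (hV : ∀ h ≤ H, Measurable (V h)) (hC : ∀ h ≤ H, ∀ s, |V h s| ≤ C)
    (hVH : ∀ s, V H s = 0)
    (hNash : ∀ h < H, ∀ s, IsMatrixNash (Q h s) (π'.kernel h s) (ν.kernel h s) ∧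
      V h s = payoff (Q h s) (π'.kernel h s) (ν.kernel h s))
    (hQ : ∀ h < H, ∀ s a b, |Q h s a b - bellman M h (V (h + 1)) (s, a, b)| ≤ ε) :
    ∀ k h, h + k = H → ∀ s, value M π ν h s ≤ V h s + k * ε := by
  intro k
  induction k with
  | zero =>
    intro h hh s
    obtain rfl : h = H := hh
    simp [value_horizon, hVH]
  | succ k ih =>
    intro h hh s
    obtain ⟨hN, e⟩ := hNash h (by omega) s
    rw [e, value_eq_payoff M π ν (by omega)]
    refine le_trans (payoff_le_add _ _ fun a b => ?_)
      (add_le_add_left (hN.2.2.1 (π.kernel h s) inferInstance) _)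
    have h1 := (abs_le.1 (hQ h (by omega) s a b)).1
    have h2 := bellman_le_add M (h := h) (measurable_value M π ν (h + 1)) (hV (h + 1) (by omega))
      (abs_value_le M π ν (h := h + 1) (by omega)) (hC (h + 1) (by omega))
      (ih (h + 1) (by omega)) (s, a, b)
    have e2 : bellman M h (value M π ν (h + 1)) (s, a, b) =
      M.r h (s, a, b) + ∫ s', value M π ν (h + 1) s' ∂M.P h (s, a, b) := rfl
    rw [← e2]
    push_cast
    linarith

/-- Compares two approximate iterations through the mixed pair `(π', ν')`: `ν` minimizes against
`π'` in `Q`, and `π` maximizes against `ν'` in `R`. Passing from `Q` to `R` costs `2 * ε` per step.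
-/
theorem nash_value_le_add (hV : ∀ h ≤ H, Measurable (V h)) (hW : ∀ h ≤ H, Measurable (W h))
    (hC : ∀ h ≤ H, ∀ s, |V h s| ≤ C) (hD : ∀ h ≤ H, ∀ s, |W h s| ≤ C)
    (hVH : ∀ s, V H s = 0) (hWH : ∀ s, W H s = 0)
    (hNV : ∀ h < H, ∀ s, IsMatrixNash (Q h s) (π'.kernel h s) (ν.kernel h s) ∧
      V h s = payoff (Q h s) (π'.kernel h s) (ν.kernel h s))
    (hNW : ∀ h < H, ∀ s, IsMatrixNash (R h s) (π.kernel h s) (ν'.kernel h s) ∧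
      W h s = payoff (R h s) (π.kernel h s) (ν'.kernel h s))
    (hQ : ∀ h < H, ∀ s a b, |Q h s a b - bellman M h (V (h + 1)) (s, a, b)| ≤ ε)
    (hR : ∀ h < H, ∀ s a b, |R h s a b - bellman M h (W (h + 1)) (s, a, b)| ≤ ε) :
    ∀ k h, h + k = H → ∀ s, V h s ≤ W h s + k * (2 * ε) := by
  intro k
  induction k with
  | zero =>
    intro h hh s
    obtain rfl : h = H := hh
    simp [hVH, hWH]
  | succ k ih =>
    intro h hh s
    obtain ⟨hN, e⟩ := hNV h (by omega) s
    obtain ⟨hN', e'⟩ := hNW h (by omega) s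
    rw [e, e']
    refine (hN.2.2.2 (ν'.kernel h s) inferInstance).trans ?_
    refine le_trans (payoff_le_add _ _ fun a b => ?_)
      (add_le_add_left (hN'.2.2.1 (π'.kernel h s) inferInstance) _)
    have h1 := (abs_le.1 (hQ h (by omega) s a b)).2
    have h2 := (abs_le.1 (hR h (by omega) s a b)).1
    have h3 := bellman_le_add M (h := h) (hV (h + 1) (by omega)) (hW (h + 1) (by omega))
      (hC (h + 1) (by omega)) (hD (h + 1) (by omega)) (ih (h + 1) (by omega)) (s, a, b)
    push_cast
    linarith

/-- Approximate minimax value iteration: if the matrix games solved at every step approximate the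
Bellman operators up to `ε`, then the resulting policies have duality gap at most `4 H ε`. -/
theorem dualityGap_le (hV : ∀ h ≤ H, Measurable (V h)) (hW : ∀ h ≤ H, Measurable (W h))
    (hC : ∀ h ≤ H, ∀ s, |V h s| ≤ C) (hD : ∀ h ≤ H, ∀ s, |W h s| ≤ C)
    (hVH : ∀ s, V H s = 0) (hWH : ∀ s, W H s = 0)
    (hNV : ∀ h < H, ∀ s, IsMatrixNash (Q h s) (π'.kernel h s) (ν.kernel h s) ∧
      V h s = payoff (Q h s) (π'.kernel h s) (ν.kernel h s))
    (hNW : ∀ h < H, ∀ s, IsMatrixNash (R h s) (π.kernel h s) (ν'.kernel h s) ∧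
      W h s = payoff (R h s) (π.kernel h s) (ν'.kernel h s))
    (hQ : ∀ h < H, ∀ s a b, |Q h s a b - bellman M h (V (h + 1)) (s, a, b)| ≤ ε)
    (hR : ∀ h < H, ∀ s a b, |R h s a b - bellman M h (W (h + 1)) (s, a, b)| ≤ ε) (x : S) :
    dualityGap M π ν x ≤ 4 * H * ε := by
  have : Nonempty (Policy S A) := ⟨π⟩
  have : Nonempty (Policy S B) := ⟨ν⟩
  have h1 : valueBestMax M ν 0 x ≤ V 0 x + H * ε :=
    ciSup_le fun π₁ => value_le_of_nash hV hC hVH hNV hQ H 0 (zero_add _) x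
  have h2 : W 0 x - H * ε ≤ valueBestMin M π 0 x :=
    le_ciInf fun ν₁ => sub_le_iff_le_add.2
      (le_value_of_nash hW hD hWH hNW hR H 0 (zero_add _) x)
  have h3 := nash_value_le_add hV hW hC hD hVH hWH hNV hNW hQ hR H 0 (zero_add _) x
  unfold dualityGap
  linarith

end DualityGap

/-! ### Inverses of coercive matrices -/

section CoerciveMatrix

open Matrix

variable {n : Type*} [Fintype n]

theorem zero_le_dotProduct_self (x : n → ℝ) : 0 ≤ x ⬝ᵥ x :=
  Finset.sum_nonneg fun i _ => mul_self_nonneg (x i)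

theorem abs_dotProduct_le (x y : n → ℝ) : |x ⬝ᵥ y| ≤ √(x ⬝ᵥ x) * √(y ⬝ᵥ y) := by
  have h : ∀ x y : n → ℝ, x ⬝ᵥ y ≤ √(x ⬝ᵥ x) * √(y ⬝ᵥ y) := fun x y => by
    simpa [dotProduct, sq] using Real.sum_mul_le_sqrt_mul_sqrt Finset.univ x y
  refine abs_le'.2 ⟨h x y, ?_⟩
  simpa using h (-x) y

variable [DecidableEq n] {L : Matrix n n ℝ} {κ : ℝ}

theorem mulVec_inv_mulVec_of_coercive (hκ : 0 < κ)
    (hL : ∀ x, κ * (x ⬝ᵥ x) ≤ x ⬝ᵥ L *ᵥ x) (v : n → ℝ) : L *ᵥ (L⁻¹ *ᵥ v) = v := by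
  have hinj : Function.Injective L.mulVec := by
    intro x y hxy
    have h0 : L *ᵥ (x - y) = 0 := by rw [mulVec_sub]; exact sub_eq_zero.2 hxy
    have h1 := hL (x - y)
    rw [h0, dotProduct_zero] at h1
    have h2 := zero_le_dotProduct_self (x - y)
    have h3 : (x - y) ⬝ᵥ (x - y) = 0 := by nlinarith
    exact sub_eq_zero.1 (dotProduct_self_eq_zero.1 h3)
  have hu : IsUnit L := mulVec_injective_iff_isUnit.1 hinj
  rw [mulVec_mulVec, mul_nonsing_inv _ ((isUnit_iff_isUnit_det L).1 hu), one_mulVec]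

/-- With `a` the norm of `L⁻¹ v`, coercivity and Cauchy-Schwarz give `κ a² ≤ ⟨L⁻¹ v, v⟩ ≤ a ‖v‖`.
Symmetry of `L` is not needed. -/
theorem sqrt_inv_mulVec_le (hκ : 0 < κ) (hL : ∀ x, κ * (x ⬝ᵥ x) ≤ x ⬝ᵥ L *ᵥ x) (v : n → ℝ) :
    √(L⁻¹ *ᵥ v ⬝ᵥ L⁻¹ *ᵥ v) ≤ √(v ⬝ᵥ v) / κ := by
  have h1 := hL (L⁻¹ *ᵥ v)
  rw [mulVec_inv_mulVec_of_coercive hκ hL] at h1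
  have h2 := (le_abs_self _).trans (abs_dotProduct_le (L⁻¹ *ᵥ v) v)
  set a := √(L⁻¹ *ᵥ v ⬝ᵥ L⁻¹ *ᵥ v) with ha
  have ha2 : L⁻¹ *ᵥ v ⬝ᵥ L⁻¹ *ᵥ v = a * a := (Real.mul_self_sqrt (zero_le_dotProduct_self _)).symm
  have ha0 : 0 ≤ a := Real.sqrt_nonneg _
  rw [ha2] at h1
  rw [le_div_iff₀ hκ]
  rcases ha0.eq_or_lt with h | h
  · rw [← h, zero_mul]; exact Real.sqrt_nonneg _
  · refine le_of_mul_le_mul_left ?_ h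
    linarith

theorem abs_dotProduct_inv_mulVec_le (hκ : 0 < κ) (hL : ∀ x, κ * (x ⬝ᵥ x) ≤ x ⬝ᵥ L *ᵥ x)
    (u v : n → ℝ) : |u ⬝ᵥ L⁻¹ *ᵥ v| ≤ √(u ⬝ᵥ u) * √(v ⬝ᵥ v) / κ := by
  refine (abs_dotProduct_le _ _).trans ?_
  rw [mul_div_assoc]
  exact mul_le_mul_of_nonneg_left (sqrt_inv_mulVec_le hκ hL v) (Real.sqrt_nonneg _)

theorem abs_inv_apply_le (hκ : 0 < κ) (hL : ∀ x, κ * (x ⬝ᵥ x) ≤ x ⬝ᵥ L *ᵥ x) (i j : n) :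
    |L⁻¹ i j| ≤ 1 / κ := by
  simpa using abs_dotProduct_inv_mulVec_le hκ hL (Pi.single i 1) (Pi.single j 1)

/-- Shifting by `c` keeps all eigenvalues nonnegative, so the shifted matrix is positive
semidefinite. Finiteness of the spectrum makes the infimum in `lambdaMin` a genuine lower bound. -/
theorem mul_dotProduct_le_of_le_lambdaMin {d : ℕ} {M : Matrix (Fin d) (Fin d) ℝ}
    (hM : M.IsHermitian) {c : ℝ} (hc : c ≤ lambdaMin M) (x : Fin d → ℝ) :
    c * (x ⬝ᵥ x) ≤ x ⬝ᵥ M *ᵥ x := by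
  have hset : {l : ℝ | Module.End.HasEigenvalue (Matrix.toLin' M) l} = spectrum ℝ M := by
    ext l
    rw [Set.mem_ofPred_eq, Module.End.hasEigenvalue_iff_mem_spectrum, Matrix.spectrum_toLin']
  have hfin : (spectrum ℝ M).Finite := by
    rw [hM.spectrum_real_eq_range_eigenvalues]
    exact Set.finite_range _
  have hle : ∀ l ∈ spectrum ℝ M, c ≤ l := fun l hl => by
    refine hc.trans ?_
    rw [lambdaMin, hset]
    exact csInf_le hfin.bddBelow hl
  have hH : (M - c • (1 : Matrix (Fin d) (Fin d) ℝ)).IsHermitian := by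
    refine hM.sub ?_
    simp [IsHermitian]
  have hpos : (M - c • (1 : Matrix (Fin d) (Fin d) ℝ)).PosSemidef := by
    rw [hH.posSemidef_iff_eigenvalues_nonneg]
    intro i
    have h1 := hH.eigenvalues_mem_spectrum_real i
    have h2 : hH.eigenvalues i + c ∈ spectrum ℝ M := by
      have := spectrum.add_mem_iff (a := M) (r := hH.eigenvalues i) (s := c)
      rw [add_comm]
      rw [add_comm] at this
      refine this.2 ?_
      rwa [Algebra.algebraMap_eq_smul_one, neg_add_eq_sub]
    have := hle _ h2
    simpa using this
  have := hpos.dotProduct_mulVec_nonneg x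
  simp only [star_trivial, sub_mulVec, dotProduct_sub, smul_mulVec, one_mulVec,
    dotProduct_smul, smul_eq_mul] at this
  linarith

end CoerciveMatrix

/-! ### Error decomposition of ridge regression -/

section RidgeRegression

open Matrix

variable {n : Type*} [Fintype n] [DecidableEq n] {K : ℕ} (Φ : Fin K → n → ℝ)

theorem gram_mulVec (x : n → ℝ) :
    (∑ τ, vecMulVec (Φ τ) (Φ τ) + 1) *ᵥ x = ∑ τ, (Φ τ ⬝ᵥ x) • Φ τ + x := by
  rw [add_mulVec, one_mulVec, sum_mulVec]
  congr 1
  refine Finset.sum_congr rfl fun τ _ => ?_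
  rw [vecMulVec_mulVec]
  ext i
  simp [mul_comm]

theorem dotProduct_gram_mulVec (x : n → ℝ) :
    x ⬝ᵥ (∑ τ, vecMulVec (Φ τ) (Φ τ) + 1) *ᵥ x = ∑ τ, (Φ τ ⬝ᵥ x) ^ 2 + x ⬝ᵥ x := by
  rw [gram_mulVec, dotProduct_add, dotProduct_sum]
  congr 1
  refine Finset.sum_congr rfl fun τ _ => ?_
  rw [dotProduct_smul, dotProduct_comm x, smul_eq_mul, sq]

/-- For any reference weight `w`, the estimate is `w + Λ⁻¹ (noise) - Λ⁻¹ w`; the last term is the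
bias due to the identity in `Λ`. Coercivity bounds both corrections. -/
theorem abs_dotProduct_ridge_sub_le {κ : ℝ} (hκ : 0 < κ)
    (hL : ∀ x, κ * (x ⬝ᵥ x) ≤ x ⬝ᵥ (∑ τ, vecMulVec (Φ τ) (Φ τ) + 1) *ᵥ x) (y : Fin K → ℝ)
    (w v : n → ℝ) :
    |v ⬝ᵥ (∑ τ, vecMulVec (Φ τ) (Φ τ) + 1)⁻¹ *ᵥ (∑ τ, y τ • Φ τ) - v ⬝ᵥ w| ≤
      √(v ⬝ᵥ v) * (√((∑ τ, (y τ - Φ τ ⬝ᵥ w) • Φ τ) ⬝ᵥ (∑ τ, (y τ - Φ τ ⬝ᵥ w) • Φ τ))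
        + √(w ⬝ᵥ w)) / κ := by
  set L := ∑ τ, vecMulVec (Φ τ) (Φ τ) + 1
  have hw : L⁻¹ *ᵥ (L *ᵥ w) = w := by
    have h := mulVec_inv_mulVec_of_coercive hκ hL
    have h1 : L * L⁻¹ = 1 := by
      refine Matrix.ext_of_mulVec_single fun i => ?_
      rw [← mulVec_mulVec, h, one_mulVec]
    rw [mulVec_mulVec, mul_eq_one_comm.1 h1, one_mulVec]
  have h1 : ∑ τ, y τ • Φ τ = L *ᵥ w + ∑ τ, (y τ - Φ τ ⬝ᵥ w) • Φ τ - w := by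
    rw [gram_mulVec]
    simp only [sub_smul, Finset.sum_sub_distrib]
    abel
  rw [h1, mulVec_sub, mulVec_add, hw, dotProduct_sub, dotProduct_add, add_sub_assoc,
    add_sub_cancel_left]
  refine (abs_sub _ _).trans ?_
  rw [mul_add, add_div]
  exact add_le_add (abs_dotProduct_inv_mulVec_le hκ hL _ _)
    (abs_dotProduct_inv_mulVec_le hκ hL _ _)

end RidgeRegression

/-! ### Functions linear in the features -/

section FeatureSpan

open Matrix

variable {Z : Type*} {d : ℕ} {φ : Z → EuclideanSpace ℝ (Fin d)}

/-- The functions on `Z` that are linear in the feature map. -/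
noncomputable def featureSpan (φ : Z → EuclideanSpace ℝ (Fin d)) :
    Submodule ℝ (Z → ℝ) :=
  LinearMap.range (LinearMap.pi fun z => dotProductBilin ℝ ℝ (φ z).ofLp)

theorem mem_featureSpan {g : Z → ℝ} :
    g ∈ featureSpan φ ↔ ∃ w : Fin d → ℝ, ∀ z, g z = (φ z).ofLp ⬝ᵥ w := by
  constructor
  · rintro ⟨w, rfl⟩
    exact ⟨w, fun z => rfl⟩
  · rintro ⟨w, hw⟩
    exact ⟨w, funext fun z => (hw z).symm⟩

/-- A finite-dimensional subspace is closed under pointwise limits; this lets linearity of the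
transitions pass from simple functions to bounded measurable ones. -/
theorem isClosed_featureSpan : IsClosed (featureSpan φ : Set (Z → ℝ)) := by
  have : FiniteDimensional ℝ (featureSpan φ) := by unfold featureSpan; infer_instance
  exact Submodule.closed_of_finiteDimensional _

end FeatureSpan

/-! ### Bellman images and covariances in linear games -/

section LinearGame

open Matrix

variable {S A B : Type*} [MeasurableSpace S] [MeasurableSpace A] [MeasurableSpace B] {d H : ℕ}
  {M : MarkovGame S A B H} {φ : S × A × B → EuclideanSpace ℝ (Fin d)}

theorem IsLinear.feature_dotProduct_self_le (hM : IsLinear M φ) (z : S × A × B) :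
    (φ z).ofLp ⬝ᵥ (φ z).ofLp ≤ 1 := by
  have h := hM.norm_feature_le z
  have h2 : (φ z).ofLp ⬝ᵥ (φ z).ofLp = ‖φ z‖ ^ 2 := by
    rw [EuclideanSpace.real_norm_sq_eq]
    simp [dotProduct, sq]
  rw [h2]
  exact pow_le_one₀ (norm_nonneg _) h

theorem IsLinear.abs_feature_apply_le (hM : IsLinear M φ) (z : S × A × B) (i : Fin d) :
    |φ z i| ≤ 1 := by
  have h := hM.feature_dotProduct_self_le z
  have h2 : φ z i * φ z i ≤ (φ z).ofLp ⬝ᵥ (φ z).ofLp :=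
    Finset.single_le_sum (f := fun i => φ z i * φ z i) (fun i _ => mul_self_nonneg _)
      (Finset.mem_univ i)
  exact abs_le_one_iff_mul_self_le_one.2 (h2.trans h)

theorem IsLinear.measurable_feature_apply (hM : IsLinear M φ) (i : Fin d) :
    Measurable fun z => φ z i := by
  have := hM.measurable_feature
  fun_prop

/-- The transition hypothesis gives the claim for simple functions. Bounded simple approximations
converge for each `z` by dominated convergence, so integrals against signed measures are avoided. -/
theorem IsLinear.integral_mem_featureSpan (hM : IsLinear M φ) {h : ℕ} (hh : h < H) {f : S → ℝ}
    (hf : Measurable f) {C : ℝ} (hC : ∀ s, |f s| ≤ C) :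
    (fun z => ∫ s, f s ∂M.P h z) ∈ featureSpan φ := by
  obtain ⟨μ, hμ⟩ := hM.transition
  have hfs := hf.stronglyMeasurable
  have hsimple : ∀ g : SimpleFunc S ℝ, (fun z => ∫ s, g s ∂M.P h z) ∈ featureSpan φ := by
    intro g
    rw [mem_featureSpan]
    refine ⟨fun i => ∑ x ∈ g.range, x * μ h i (g ⁻¹' {x}), fun z => ?_⟩
    rw [SimpleFunc.integral_eq_sum _ (SimpleFunc.integrable_of_isFiniteMeasure g)]
    simp only [dotProduct, Finset.mul_sum]
    rw [Finset.sum_comm]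
    refine Finset.sum_congr rfl fun x _ => ?_
    rw [(hμ h hh).2 z _ (g.measurableSet_fiber x), smul_eq_mul, Finset.sum_mul]
    refine Finset.sum_congr rfl fun i _ => ?_
    ring
  refine isClosed_featureSpan.mem_of_tendsto
    (f := fun (k : ℕ) z => ∫ s, hfs.approxBounded C k s ∂M.P h z) (b := Filter.atTop) ?_
    (Filter.Eventually.of_forall fun k => hsimple _)
  refine tendsto_pi_nhds.2 fun z => ?_
  have hC0 : 0 ≤ C := by
    have : Nonempty S := ⟨z.1⟩
    exact (abs_nonneg _).trans (hC z.1)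
  refine tendsto_integral_of_dominated_convergence (fun _ => C)
    (fun k => (hfs.approxBounded C k).aestronglyMeasurable) (integrable_const _)
    (fun k => ae_of_all _ fun s => StronglyMeasurable.norm_approxBounded_le hfs hC0 k s)
    (ae_of_all _ fun s => StronglyMeasurable.tendsto_approxBounded_of_norm_le hfs (hC s))

theorem IsLinear.exists_weight (hM : IsLinear M φ) {h : ℕ} (hh : h < H) {f : S → ℝ}
    (hf : Measurable f) {C : ℝ} (hC : ∀ s, |f s| ≤ C) :
    ∃ w : Fin d → ℝ, ∀ z, bellman M h f z = (φ z).ofLp ⬝ᵥ w := by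
  obtain ⟨w, hw⟩ := mem_featureSpan.1 (hM.integral_mem_featureSpan hh hf hC)
  obtain ⟨θ, hθ⟩ := hM.reward
  refine ⟨(θ h).ofLp + w, fun z => ?_⟩
  rw [bellman, hw z, dotProduct_add, (hθ h hh).2 z, EuclideanSpace.inner_eq_star_dotProduct]
  simp [dotProduct_comm]

variable (M φ) in
theorem isHermitian_featureCov (π : Policy S A) (ν : Policy S B) (x : S) (h : Fin H) :
    (featureCov M φ π ν x h).IsHermitian := by
  ext i j
  simp [featureCov, mul_comm]

theorem IsLinear.dotProduct_featureCov_mulVec (hM : IsLinear M φ) (π : Policy S A)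
    (ν : Policy S B) (x : S) (h : Fin H) (w : Fin d → ℝ) :
    w ⬝ᵥ featureCov M φ π ν x h *ᵥ w =
      ∫ ω, ((φ (ω h)).ofLp ⬝ᵥ w) ^ 2 ∂(trajLaw M π ν H 0 x) := by
  have hint : ∀ i j, Integrable (fun ω : Fin H → S × A × B => φ (ω h) i * φ (ω h) j)
      (trajLaw M π ν H 0 x) := fun i j => by
    refine integrable_of_abs_le (C := 1) ?_ fun ω => ?_
    · exact ((hM.measurable_feature_apply i).comp (measurable_pi_apply h)).mul
        ((hM.measurable_feature_apply j).comp (measurable_pi_apply h))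
    · rw [abs_mul]
      exact mul_le_one₀ (hM.abs_feature_apply_le _ _) (abs_nonneg _)
        (hM.abs_feature_apply_le _ _)
  have e : ∀ ω : Fin H → S × A × B, ((φ (ω h)).ofLp ⬝ᵥ w) ^ 2 =
      ∑ i, ∑ j, (w i * w j) * (φ (ω h) i * φ (ω h) j) := fun ω => by
    rw [sq, dotProduct, Finset.sum_mul_sum]
    refine Finset.sum_congr rfl fun i _ => Finset.sum_congr rfl fun j _ => ?_
    ring
  simp only [e]
  rw [integral_finsetSum _ fun i _ => integrable_finsetSum _ fun j _ =>
    (hint i j).const_mul _]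
  simp only [dotProduct, mulVec, Finset.mul_sum]
  refine Finset.sum_congr rfl fun i _ => ?_
  rw [integral_finsetSum _ fun j _ => (hint i j).const_mul _]
  refine Finset.sum_congr rfl fun j _ => ?_
  rw [integral_const_mul]
  simp only [featureCov, of_apply]
  ring

/-- The quadratic form of the covariance at `w` is the mean of `(φ ⬝ᵥ w)²`, so coverage turns a sup
bound on a linear function into a bound on its weight. -/
theorem IsLinear.mul_weight_le (hM : IsLinear M φ) {π : Policy S A} {ν : Policy S B} {x : S}
    {h : Fin H} {c : ℝ} (hc : c ≤ lambdaMin (featureCov M φ π ν x h)) {w : Fin d → ℝ} {m : ℝ}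
    (hw : ∀ z, |(φ z).ofLp ⬝ᵥ w| ≤ m) : c * (w ⬝ᵥ w) ≤ m ^ 2 := by
  refine (mul_dotProduct_le_of_le_lambdaMin (isHermitian_featureCov M φ π ν x h) hc w).trans ?_
  rw [hM.dotProduct_featureCov_mulVec]
  refine (le_abs_self _).trans (abs_integral_le_of_abs_le fun ω => ?_)
  rw [abs_pow]
  exact pow_le_pow_left₀ (abs_nonneg _) (hw _) 2

end LinearGame

/-! ### Union bound and Hoeffding's inequality over episodes -/

section Hoeffding

theorem measure_iUnion_le_card_mul {X ι : Type*} [MeasurableSpace X] [Fintype ι] (μ : Measure X)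
    (s : ι → Set X) {e : ℝ} (hs : ∀ i, μ (s i) ≤ ENNReal.ofReal e) :
    μ (⋃ i, s i) ≤ ENNReal.ofReal (Fintype.card ι * e) := by
  refine (measure_iUnion_fintype_le μ s).trans ((Finset.sum_le_sum fun i _ => hs i).trans ?_)
  rw [Finset.sum_const, nsmul_eq_mul, ENNReal.ofReal_mul (by positivity), ENNReal.ofReal_natCast]
  rfl

theorem hoeffding_pi {Ω : Type*} [MeasurableSpace Ω] (T : Measure Ω) [IsProbabilityMeasure T]
    {X : Ω → ℝ} (hX : Measurable X) {a : ℝ} (hb : ∀ ω, |X ω| ≤ a) (h0 : ∫ ω, X ω ∂T = 0) (K : ℕ)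
    {t : ℝ} (ht : 0 ≤ t) :
    Measure.pi (fun _ : Fin K => T) {ω | t ≤ ∑ τ, X (ω τ)} ≤
      ENNReal.ofReal (Real.exp (-t ^ 2 / (2 * (K * a ^ 2)))) := by
  have hind : iIndepFun (fun (τ : Fin K) (ω : Fin K → Ω) => X (ω τ))
      (Measure.pi fun _ : Fin K => T) := iIndepFun_pi fun _ => hX.aemeasurable
  have hsub : ∀ τ ∈ (Finset.univ : Finset (Fin K)),
      HasSubgaussianMGF (fun ω : Fin K → Ω => X (ω τ)) ((‖a - (-a)‖₊ / 2) ^ 2)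
        (Measure.pi fun _ : Fin K => T) := by
    intro τ _
    refine hasSubgaussianMGF_of_mem_Icc_of_integral_eq_zero
      (hX.comp (measurable_pi_apply τ)).aemeasurable (ae_of_all _ fun ω => abs_le.1 (hb _)) ?_
    rw [← h0]
    exact integral_comp_eval hX.aestronglyMeasurable
  have h := HasSubgaussianMGF.measure_sum_ge_le_of_iIndepFun hind hsub ht
  have hc : ((∑ _τ : Fin K, (‖a - (-a)‖₊ / 2) ^ 2 : NNReal) : ℝ) = K * a ^ 2 := by
    simp only [Finset.sum_const, Finset.card_univ, Fintype.card_fin, nsmul_eq_mul, NNReal.coe_mul,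
      NNReal.coe_natCast, NNReal.coe_pow, NNReal.coe_div, coe_nnnorm, NNReal.coe_ofNat,
      Real.norm_eq_abs, div_pow, sq_abs]
    ring
  push_cast at hc h
  rw [hc] at h
  rw [← ofReal_measureReal]
  exact ENNReal.ofReal_le_ofReal h

end Hoeffding

/-! ### The parametric family of value functions -/

section ParametricValue

open Matrix

/-- Negative arguments, where the root is `0`, must be allowed: a matrix rounded to the grid need
not be positive semidefinite. -/
theorem abs_sqrt_sub_sqrt_le (a b : ℝ) : |√a - √b| ≤ √|a - b| := by
  have h : ∀ a b : ℝ, √a ≤ √b + √|a - b| := fun a b => by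
    refine Real.sqrt_le_iff.2 ⟨by positivity, ?_⟩
    have h1 : b ≤ √b ^ 2 := by
      rcases le_total 0 b with hb | hb
      · rw [Real.sq_sqrt hb]
      · exact hb.trans (sq_nonneg _)
    have h2 : √|a - b| ^ 2 = |a - b| := Real.sq_sqrt (abs_nonneg _)
    nlinarith [le_abs_self (a - b), Real.sqrt_nonneg b, Real.sqrt_nonneg |a - b|,
      mul_nonneg (Real.sqrt_nonneg b) (Real.sqrt_nonneg |a - b|)]
  refine abs_sub_le_iff.2 ⟨by linarith [h a b], ?_⟩
  rw [abs_sub_comm]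
  linarith [h b a]

theorem clip_mem_Icc {m : ℝ} (hm : 0 ≤ m) (y : ℝ) : clip m y ∈ Set.Icc 0 m :=
  ⟨le_min hm (le_max_right _ _), min_le_left _ _⟩

theorem abs_clip_sub_clip_le (m x y : ℝ) : |clip m x - clip m y| ≤ |x - y| := by
  unfold clip
  refine (abs_min_sub_min_le_max _ _ _ _).trans ?_
  rw [sub_self, abs_zero, max_eq_right (abs_nonneg _)]
  refine (abs_max_sub_max_le_max _ _ _ _).trans ?_
  rw [sub_self, abs_zero, max_eq_left (abs_nonneg _)]

theorem abs_clip_sub_le {m y t : ℝ} (ht : t ∈ Set.Icc 0 m) : |clip m y - t| ≤ |y - t| := by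
  have : clip m t = t := by
    rw [clip, max_eq_left ht.1, min_eq_right ht.2]
  calc |clip m y - t| = |clip m y - clip m t| := by rw [this]
    _ ≤ |y - t| := abs_clip_sub_clip_le _ _ _

variable {S A B : Type*} {d : ℕ}

/-- The truncated linear function with weight `w` and elliptical bonus `b √(φᵀ L φ)`. -/
noncomputable def bonusQ (φ : S × A × B → EuclideanSpace ℝ (Fin d)) (m b : ℝ) (w : Fin d → ℝ)
    (L : Matrix (Fin d) (Fin d) ℝ) (s : S) (a : A) (a' : B) : ℝ :=
  clip m ((φ (s, a, a')).ofLp ⬝ᵥ w +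
    b * √((φ (s, a, a')).ofLp ⬝ᵥ L *ᵥ (φ (s, a, a')).ofLp))

theorem upperQ_eq_bonusQ {K H : ℕ} (φ : S × A × B → EuclideanSpace ℝ (Fin d)) (β : ℝ)
    (D : Dataset S A B K H) (V : S → ℝ) (h : Fin H) :
    upperQ φ β D V h = bonusQ φ ((H : ℝ) - (h : ℕ)) β (ridge φ D V h) (gram φ D h)⁻¹ := rfl

theorem lowerQ_eq_bonusQ {K H : ℕ} (φ : S × A × B → EuclideanSpace ℝ (Fin d)) (β : ℝ)
    (D : Dataset S A B K H) (V : S → ℝ) (h : Fin H) :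
    lowerQ φ β D V h = bonusQ φ ((H : ℝ) - (h : ℕ)) (-β) (ridge φ D V h) (gram φ D h)⁻¹ := by
  funext s a b
  rw [lowerQ, bonusQ, bonus, neg_mul, ← sub_eq_add_neg]

theorem abs_dotProduct_le_of_abs_le {x y : Fin d → ℝ} {δ : ℝ} (hx : ∀ i, |x i| ≤ 1)
    (hy : ∀ i, |y i| ≤ δ) : |x ⬝ᵥ y| ≤ d * δ := by
  refine (Finset.abs_sum_le_sum_abs _ _).trans ?_
  refine (Finset.sum_le_sum (g := fun _ => δ) fun i _ => ?_).trans (by simp)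
  rw [abs_mul]
  exact (mul_le_mul (hx i) (hy i) (abs_nonneg _) zero_le_one).trans_eq (one_mul δ)

theorem abs_quadratic_le_of_abs_le {x : Fin d → ℝ} {L : Matrix (Fin d) (Fin d) ℝ} {δ : ℝ}
    (hx : ∀ i, |x i| ≤ 1) (hL : ∀ i j, |L i j| ≤ δ) : |x ⬝ᵥ L *ᵥ x| ≤ d ^ 2 * δ := by
  refine (abs_dotProduct_le_of_abs_le hx fun i => ?_).trans_eq (b := d * (d * δ)) (by ring)
  rw [mulVec, dotProduct_comm]
  exact abs_dotProduct_le_of_abs_le hx fun j => hL i j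

/-- The square root in the bonus makes the dependence on `L` only Hölder of order `1 / 2`, which is
why the grid must be as fine as `K⁻⁶`. -/
theorem abs_bonusQ_sub_le {φ : S × A × B → EuclideanSpace ℝ (Fin d)}
    (hφ : ∀ z i, |φ z i| ≤ 1) {m b β δ : ℝ} (hb : |b| ≤ β) {w w' : Fin d → ℝ}
    {L L' : Matrix (Fin d) (Fin d) ℝ} (hw : ∀ i, |w i - w' i| ≤ δ)
    (hL : ∀ i j, |L i j - L' i j| ≤ δ) (s : S) (a : A) (a' : B) :
    |bonusQ φ m b w L s a a' - bonusQ φ m b w' L' s a a'| ≤ d * δ + β * √(d ^ 2 * δ) := by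
  refine (abs_clip_sub_clip_le _ _ _).trans ?_
  set v := (φ (s, a, a')).ofLp
  have hv : ∀ i, |v i| ≤ 1 := hφ _
  have e : v ⬝ᵥ w + b * √(v ⬝ᵥ L *ᵥ v) - (v ⬝ᵥ w' + b * √(v ⬝ᵥ L' *ᵥ v)) =
      v ⬝ᵥ (w - w') + b * (√(v ⬝ᵥ L *ᵥ v) - √(v ⬝ᵥ L' *ᵥ v)) := by
    rw [dotProduct_sub]; ring
  rw [e]
  refine (abs_add_le _ _).trans (add_le_add (abs_dotProduct_le_of_abs_le hv hw) ?_)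
  rw [abs_mul]
  refine mul_le_mul hb ?_ (abs_nonneg _) ((abs_nonneg _).trans hb)
  refine (abs_sqrt_sub_sqrt_le _ _).trans (Real.sqrt_le_sqrt ?_)
  rw [← dotProduct_sub, ← sub_mulVec]
  exact abs_quadratic_le_of_abs_le hv hL

theorem bonusQ_mem_Icc (φ : S × A × B → EuclideanSpace ℝ (Fin d)) {m : ℝ} (hm : 0 ≤ m) (b : ℝ)
    (w : Fin d → ℝ) (L : Matrix (Fin d) (Fin d) ℝ) (s : S) (a : A) (a' : B) :
    bonusQ φ m b w L s a a' ∈ Set.Icc 0 m :=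
  clip_mem_Icc hm _

variable [MeasurableSpace A] [MeasurableSpace B] [Fintype A] [Fintype B]

/-- The value of the matrix games given by `bonusQ`. -/
noncomputable def bonusValue (φ : S × A × B → EuclideanSpace ℝ (Fin d)) (m b : ℝ) (w : Fin d → ℝ)
    (L : Matrix (Fin d) (Fin d) ℝ) (s : S) : ℝ :=
  gameValue (bonusQ φ m b w L s)

variable [MeasurableSingletonClass A] [MeasurableSingletonClass B] [Nonempty A] [Nonempty B]

theorem abs_bonusValue_sub_le {φ : S × A × B → EuclideanSpace ℝ (Fin d)}
    (hφ : ∀ z i, |φ z i| ≤ 1) {m b β δ : ℝ} (hb : |b| ≤ β) {w w' : Fin d → ℝ}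
    {L L' : Matrix (Fin d) (Fin d) ℝ} (hw : ∀ i, |w i - w' i| ≤ δ)
    (hL : ∀ i j, |L i j - L' i j| ≤ δ) (s : S) :
    |bonusValue φ m b w L s - bonusValue φ m b w' L' s| ≤ d * δ + β * √(d ^ 2 * δ) :=
  abs_gameValue_sub_le fun a a' => abs_bonusQ_sub_le hφ hb hw hL s a a'

theorem bonusValue_mem_Icc (φ : S × A × B → EuclideanSpace ℝ (Fin d)) {m : ℝ} (hm : 0 ≤ m)
    (b : ℝ) (w : Fin d → ℝ) (L : Matrix (Fin d) (Fin d) ℝ) (s : S) :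
    bonusValue φ m b w L s ∈ Set.Icc 0 m :=
  gameValue_mem_Icc fun a a' => bonusQ_mem_Icc φ hm b w L s a a'

theorem measurable_bonusValue [MeasurableSpace S] {φ : S × A × B → EuclideanSpace ℝ (Fin d)}
    (hφ : Measurable φ) (m b : ℝ) (w : Fin d → ℝ) (L : Matrix (Fin d) (Fin d) ℝ) :
    Measurable (bonusValue φ m b w L) := by
  refine measurable_gameValue fun a a' => ?_
  have h1 : ∀ i, Measurable fun s : S => φ (s, a, a') i := fun i => by
    have : Measurable fun s : S => φ (s, a, a') :=
      hφ.comp (measurable_id.prodMk measurable_const)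
    fun_prop
  unfold bonusQ clip
  simp only [dotProduct, mulVec]
  refine measurable_const.min (Measurable.max ?_ measurable_const)
  refine (Finset.measurable_sum _ fun i _ => (h1 i).mul_const _).add
    (measurable_const.mul (Measurable.sqrt (Finset.measurable_sum _ fun i _ => (h1 i).mul
      (Finset.measurable_sum _ fun j _ => (h1 j).const_mul _))))

end ParametricValue

/-! ### Concentration for fixed and for gridded parameters -/

section Concentration

open Matrix

variable {S A B : Type*} [MeasurableSpace S] [MeasurableSpace A] [MeasurableSpace B] {d H : ℕ}
  (M : MarkovGame S A B H) (φ : S × A × B → EuclideanSpace ℝ (Fin d))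

/-- The fluctuation of the value of the state following the step `h` around its conditional mean,
weighted by the feature in the direction `u`. -/
noncomputable def noise (f : S → ℝ) (u : Fin d → ℝ) (h : Fin H) (hh : (h : ℕ) + 1 < H)
    (ω : Fin H → S × A × B) : ℝ :=
  ((φ (ω h)).ofLp ⬝ᵥ u) * (f (ω ⟨h + 1, hh⟩).1 - ∫ s, f s ∂M.P h (ω h))

variable {M φ}

theorem IsLinear.measurable_feature_dotProduct (hM : IsLinear M φ) (u : Fin d → ℝ) :
    Measurable fun z => (φ z).ofLp ⬝ᵥ u :=
  Finset.measurable_sum _ fun i _ => (hM.measurable_feature_apply i).mul_const _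

theorem IsLinear.abs_feature_dotProduct_le (hM : IsLinear M φ) {u : Fin d → ℝ} {r : ℝ}
    (hr : 0 ≤ r) (hu : u ⬝ᵥ u ≤ r ^ 2) (z : S × A × B) : |(φ z).ofLp ⬝ᵥ u| ≤ r := by
  refine (abs_dotProduct_le _ _).trans ?_
  have h1 : √((φ z).ofLp ⬝ᵥ (φ z).ofLp) ≤ 1 :=
    Real.sqrt_le_one.2 (hM.feature_dotProduct_self_le z)
  have h2 : √(u ⬝ᵥ u) ≤ r := Real.sqrt_le_iff.2 ⟨hr, hu⟩
  exact (mul_le_mul h1 h2 (Real.sqrt_nonneg _) zero_le_one).trans_eq (one_mul r)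

theorem abs_sub_integral_le {X : Type*} [MeasurableSpace X] (μ : Measure X)
    [IsProbabilityMeasure μ] {f : X → ℝ} (hf : Measurable f) {m : ℝ}
    (hm : ∀ x, f x ∈ Set.Icc 0 m) (x : X) : |f x - ∫ y, f y ∂μ| ≤ m := by
  have h0 : 0 ≤ ∫ y, f y ∂μ := integral_nonneg fun y => (hm y).1
  have h1 : ∫ y, f y ∂μ ≤ m := by
    have := integral_mono (μ := μ) (integrable_of_abs_le hf (C := m)
      fun y => abs_le.2 ⟨by linarith [(hm y).1, (hm y).2], (hm y).2⟩) (integrable_const m)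
      fun y => (hm y).2
    simpa using this
  exact abs_le.2 ⟨by linarith [(hm x).1], by linarith [(hm x).2]⟩

theorem IsLinear.measure_exists_cov_le (hM : IsLinear M φ) (π : Policy S A) (ν : Policy S B)
    (x : S) {K : ℕ} {η : ℝ} (hη : 0 ≤ η) :
    episodesLaw M π ν x K {ω | ∃ (h : Fin H) (i j : Fin d), K * η ≤
        |∑ τ, (φ (ω τ h) i * φ (ω τ h) j - featureCov M φ π ν x h i j)|} ≤
      ENNReal.ofReal (H * 2 * d ^ 2 * Real.exp (-(K * η ^ 2) / 8)) := by
  -- The Boolean is a sign, reducing the two-sided bound to one-sided Hoeffding; it is the factor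
  -- `2`.
  let ι := Fin H × Bool × Fin d × Fin d
  let sg : Bool → ℝ := fun σ => if σ then 1 else -1
  have hsg : ∀ σ, |sg σ| = 1 := fun σ => by cases σ <;> simp [sg]
  let s : ι → Set (Fin K → Fin H → S × A × B) := fun i => {ω | K * η ≤
    ∑ τ, sg i.2.1 * (φ (ω τ i.1) i.2.2.1 * φ (ω τ i.1) i.2.2.2 -
      featureCov M φ π ν x i.1 i.2.2.1 i.2.2.2)}
  have hs : ∀ i, episodesLaw M π ν x K (s i) ≤
      ENNReal.ofReal (Real.exp (-(K * η ^ 2) / 8)) := by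
    rintro ⟨h, σ, i, j⟩
    have hm : Measurable fun ω : Fin H → S × A × B => φ (ω h) i * φ (ω h) j :=
      ((hM.measurable_feature_apply i).comp (measurable_pi_apply h)).mul
        ((hM.measurable_feature_apply j).comp (measurable_pi_apply h))
    have hb : ∀ ω : Fin H → S × A × B, |φ (ω h) i * φ (ω h) j| ≤ 1 := fun ω => by
      rw [abs_mul]
      exact mul_le_one₀ (hM.abs_feature_apply_le _ _) (abs_nonneg _)
        (hM.abs_feature_apply_le _ _)
    have hcov : |featureCov M φ π ν x h i j| ≤ 1 := abs_integral_le_of_abs_le hb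
    have := hoeffding_pi (trajLaw M π ν H 0 x)
      (X := fun ω => sg σ * (φ (ω h) i * φ (ω h) j - featureCov M φ π ν x h i j))
      (measurable_const.mul (hm.sub measurable_const)) (a := 2) (fun ω => by
        rw [abs_mul, hsg, one_mul]
        exact (abs_sub _ _).trans (by linarith [hb ω])) (by
        rw [integral_const_mul, integral_sub (integrable_of_abs_le hm hb) (integrable_const _)]
        simp [featureCov]) K (t := K * η) (by positivity)
    refine this.trans_eq ?_
    congr 2
    rcases K.eq_zero_or_pos with rfl | hK
    · simp
    · have : (K : ℝ) ≠ 0 := by positivity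
      field_simp
      norm_num
  have hcard : (Fintype.card ι : ℝ) = H * 2 * d ^ 2 := by
    simp only [ι, Fintype.card_prod, Fintype.card_fin, Fintype.card_bool]
    push_cast
    ring
  rw [← hcard]
  refine (measure_mono ?_).trans (measure_iUnion_le_card_mul _ s hs)
  rintro ω ⟨h, i, j, hω⟩
  rcases le_abs'.1 hω with h1 | h1
  · refine Set.mem_iUnion.2 ⟨(h, false, i, j), ?_⟩
    simp only [s, sg, Set.mem_ofPred_eq, ← Finset.mul_sum]
    rw [if_neg Bool.false_ne_true, neg_one_mul]
    linarith
  · refine Set.mem_iUnion.2 ⟨(h, true, i, j), ?_⟩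
    simp only [s, sg, Set.mem_ofPred_eq, ← Finset.mul_sum]
    simpa using h1

variable [Fintype A] [MeasurableSingletonClass A] [Fintype B] [MeasurableSingletonClass B]

/-- The noise is centered by the Markov property and bounded by `2 * H`, since `u` has norm at most
`2`. The slack over norm `1` leaves room for rounded unit vectors. -/
theorem IsLinear.measure_sum_noise_le (hM : IsLinear M φ) (π : Policy S A) (ν : Policy S B)
    (x : S) (K : ℕ) {f : S → ℝ} (hf : Measurable f) (hfH : ∀ s, f s ∈ Set.Icc (0 : ℝ) H)
    {u : Fin d → ℝ} (hu : u ⬝ᵥ u ≤ 4) (h : Fin H) (hh : (h : ℕ) + 1 < H) {t : ℝ} (ht : 0 ≤ t) :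
    episodesLaw M π ν x K {ω | t ≤ ∑ τ, noise M φ f u h hh (ω τ)} ≤
      ENNReal.ofReal (Real.exp (-t ^ 2 / (8 * (K * H ^ 2)))) := by
  have hfC : ∀ s, |f s| ≤ H := fun s =>
    abs_le.2 ⟨by linarith [(hfH s).1, (hfH s).2], (hfH s).2⟩
  have hu2 : u ⬝ᵥ u ≤ 2 ^ 2 := by linarith
  have hX : Measurable (noise M φ f u h hh) :=
    ((hM.measurable_feature_dotProduct u).comp (measurable_pi_apply h)).mul
      ((hf.comp (measurable_fst.comp (measurable_pi_apply _))).sub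
        ((measurable_kernel_integral (M.P h) hf).comp (measurable_pi_apply h)))
  have hb : ∀ ω, |noise M φ f u h hh ω| ≤ 2 * H := fun ω => by
    rw [noise, abs_mul]
    exact mul_le_mul (hM.abs_feature_dotProduct_le zero_le_two hu2 _)
      (abs_sub_integral_le _ hf hfH _) (abs_nonneg _) zero_le_two
  have h0 : ∫ ω, noise M φ f u h hh ω ∂trajLaw M π ν H 0 x = 0 := by
    have := integral_trajLaw_transition M π ν hf hfC (hM.measurable_feature_dotProduct u)
      (hM.abs_feature_dotProduct_le zero_le_two hu2) h H 0 x hh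
    simp only [zero_add] at this
    exact this
  refine (hoeffding_pi (trajLaw M π ν H 0 x) hX hb h0 K ht).trans_eq ?_
  congr 2
  ring

variable [Nonempty A] [Nonempty B]

theorem IsLinear.measure_exists_noise_le (hM : IsLinear M φ) (π : Policy S A) (ν : Policy S B)
    (x : S) (K : ℕ) (G : Finset ℝ) (b : Bool → ℝ) {t : ℝ} (ht : 0 ≤ t) :
    episodesLaw M π ν x K {ω | ∃ (h : Fin H) (hh : (h : ℕ) + 1 < H) (σ : Bool)
        (u w : Fin d → G) (L : Fin d → Fin d → G),
        (fun i => (u i : ℝ)) ⬝ᵥ (fun i => (u i : ℝ)) ≤ 4 ∧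
        t ≤ ∑ τ, noise M φ (bonusValue φ ((H : ℝ) - ((h : ℕ) + 1 : ℕ)) (b σ) (fun i => (w i : ℝ))
          (fun i j => (L i j : ℝ))) (fun i => (u i : ℝ)) h hh (ω τ)} ≤
      ENNReal.ofReal (H * 2 * G.card ^ (d + d + d * d) *
        Real.exp (-t ^ 2 / (8 * (K * H ^ 2)))) := by
  let ι := Fin H × Bool × (Fin d → G) × (Fin d → G) × (Fin d → Fin d → G)
  let s : ι → Set (Fin K → Fin H → S × A × B) := fun i => {ω | ∃ (hh : (i.1 : ℕ) + 1 < H),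
    (fun j => (i.2.2.1 j : ℝ)) ⬝ᵥ (fun j => (i.2.2.1 j : ℝ)) ≤ 4 ∧
        t ≤ ∑ τ, noise M φ (bonusValue φ ((H : ℝ) - ((i.1 : ℕ) + 1 : ℕ)) (b i.2.1)
          (fun j => (i.2.2.2.1 j : ℝ))
          (fun j k => (i.2.2.2.2 j k : ℝ))) (fun j => (i.2.2.1 j : ℝ)) i.1 hh (ω τ)}
  have hs : ∀ i, episodesLaw M π ν x K (s i) ≤
      ENNReal.ofReal (Real.exp (-t ^ 2 / (8 * (K * H ^ 2)))) := by
    intro i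
    by_cases hh : (i.1 : ℕ) + 1 < H
    · by_cases hu : (fun j => (i.2.2.1 j : ℝ)) ⬝ᵥ (fun j => (i.2.2.1 j : ℝ)) ≤ 4
      · refine (measure_mono ?_).trans (hM.measure_sum_noise_le π ν x K
          (measurable_bonusValue hM.measurable_feature ((H : ℝ) - ((i.1 : ℕ) + 1 : ℕ)) (b i.2.1)
          (fun j => (i.2.2.2.1 j : ℝ)) (fun j k => (i.2.2.2.2 j k : ℝ))) (fun s => ?_) hu i.1 hh ht)
        · rintro ω ⟨_, _, hω⟩
          exact hω
        · have hm : (0 : ℝ) ≤ (H : ℝ) - ((i.1 : ℕ) + 1 : ℕ) :=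
            sub_nonneg.2 (by exact_mod_cast hh.le)
          have := bonusValue_mem_Icc φ hm (b i.2.1)
            (fun j => (i.2.2.2.1 j : ℝ)) (fun j k => (i.2.2.2.2 j k : ℝ)) s
          refine ⟨this.1, this.2.trans (sub_le_self _ (Nat.cast_nonneg _))⟩
      · have : s i = ∅ := Set.eq_empty_of_forall_notMem fun ω hω => hu hω.2.1
        rw [this, measure_empty]
        exact zero_le
    · have : s i = ∅ := Set.eq_empty_of_forall_notMem fun ω hω => hh hω.1
      rw [this, measure_empty]
      exact zero_le
  have hcard : (Fintype.card ι : ℝ) = H * 2 * G.card ^ (d + d + d * d) := by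
    simp only [ι, Fintype.card_prod, Fintype.card_fin, Fintype.card_bool, Fintype.card_pi,
      Fintype.card_coe, Finset.prod_const, Finset.card_univ, Nat.cast_mul, Nat.cast_pow,
      pow_add, pow_mul]
    push_cast
    ring
  rw [← hcard]
  refine (measure_mono ?_).trans (measure_iUnion_le_card_mul _ s hs)
  rintro ω ⟨h, hh, σ, u, w, L, hω⟩
  exact Set.mem_iUnion.2 ⟨(h, σ, u, w, L), hh, hω⟩

end Concentration

/-! ### Rounding parameters and directions to a grid -/

section Discretization

open Matrix

/-- The multiples of `K⁻⁶` in `[-K², K²]` number `2 K⁸ + 1`, which is at most `K⁹` once `K ≥ 3`. -/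
theorem exists_grid {K : ℕ} (hK : 3 ≤ K) : ∃ G : Finset ℝ, G.card ≤ K ^ 9 ∧
    ∀ y : ℝ, |y| ≤ K ^ 2 → ∃ g ∈ G, |y - g| ≤ 1 / (K : ℝ) ^ 6 := by
  have hK0 : (0 : ℝ) < K := by exact_mod_cast (by omega : 0 < K)
  refine ⟨(Finset.Icc (-(K : ℤ) ^ 8) ((K : ℤ) ^ 8)).image fun j : ℤ => (j : ℝ) / K ^ 6,
    Finset.card_image_le.trans ?_, fun y hy => ?_⟩
  · rw [Int.card_Icc]
    have h1 : (K : ℤ) ^ 9 = K ^ 8 * K := by ring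
    have h2 : (1 : ℤ) ≤ (K : ℤ) ^ 8 := one_le_pow₀ (by omega)
    have h3 : (3 : ℤ) ≤ K := by exact_mod_cast hK
    zify
    rw [Int.toNat_of_nonneg (by linarith)]
    nlinarith
  · have h0 : (0 : ℝ) < (K : ℝ) ^ 6 := by positivity
    have hy8 : |y * K ^ 6| ≤ (K : ℝ) ^ 8 := by
      rw [abs_mul, abs_of_pos h0]
      calc |y| * (K : ℝ) ^ 6 ≤ (K : ℝ) ^ 2 * (K : ℝ) ^ 6 := by gcongr
        _ = (K : ℝ) ^ 8 := by ring
    obtain ⟨hl, hr⟩ := abs_le.1 hy8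
    refine ⟨(⌊y * K ^ 6⌋ : ℝ) / K ^ 6, Finset.mem_image.2 ⟨_, Finset.mem_Icc.2 ⟨?_, ?_⟩, rfl⟩, ?_⟩
    · refine Int.le_floor.2 ?_
      push_cast
      exact hl
    · have : (⌊y * K ^ 6⌋ : ℝ) ≤ (K : ℝ) ^ 8 := (Int.floor_le _).trans hr
      exact_mod_cast this
    · have e : y - (⌊y * K ^ 6⌋ : ℝ) / K ^ 6 = (y * K ^ 6 - ⌊y * K ^ 6⌋) / K ^ 6 := by
        field_simp
      rw [e, abs_div, abs_of_pos h0]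
      refine div_le_div_of_nonneg_right ?_ h0.le
      rw [abs_of_nonneg (by linarith [Int.floor_le (y * K ^ 6)])]
      linarith [Int.lt_floor_add_one (y * K ^ 6)]

variable {S A B : Type*} [MeasurableSpace S] [MeasurableSpace A] [MeasurableSpace B] {d H K : ℕ}
  {M : MarkovGame S A B H} {φ : S × A × B → EuclideanSpace ℝ (Fin d)}

variable (M φ) in
/-- The vector whose inner product with `u` is the total `noise` in the direction `u`. -/
noncomputable def noiseVec (f : S → ℝ) (h : Fin H) (hh : (h : ℕ) + 1 < H)
    (ω : Fin K → Fin H → S × A × B) : Fin d → ℝ :=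
  ∑ τ, (f (ω τ ⟨h + 1, hh⟩).1 - ∫ s, f s ∂M.P h (ω τ h)) • (φ (ω τ h)).ofLp

theorem noiseVec_dotProduct (f : S → ℝ) (h : Fin H) (hh : (h : ℕ) + 1 < H)
    (ω : Fin K → Fin H → S × A × B) (u : Fin d → ℝ) :
    noiseVec M φ f h hh ω ⬝ᵥ u = ∑ τ, noise M φ f u h hh (ω τ) := by
  rw [noiseVec, sum_dotProduct]
  refine Finset.sum_congr rfl fun τ _ => ?_
  rw [smul_dotProduct, noise, smul_eq_mul, mul_comm]

theorem noise_le_add (hM : IsLinear M φ) {f g : S → ℝ} (hf : Measurable f) (hg : Measurable g)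
    {C η : ℝ} (hfC : ∀ s, |f s| ≤ C) (hgC : ∀ s, |g s| ≤ C) (hfg : ∀ s, |f s - g s| ≤ η)
    {u : Fin d → ℝ} (hu : u ⬝ᵥ u ≤ 4) (h : Fin H) (hh : (h : ℕ) + 1 < H)
    (ω : Fin H → S × A × B) :
    noise M φ f u h hh ω ≤ noise M φ g u h hh ω + 4 * η := by
  have e : noise M φ f u h hh ω - noise M φ g u h hh ω = ((φ (ω h)).ofLp ⬝ᵥ u) *
      ((f (ω ⟨h + 1, hh⟩).1 - g (ω ⟨h + 1, hh⟩).1) - ∫ s, (f s - g s) ∂M.P h (ω h)) := by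
    rw [integral_sub (integrable_of_abs_le hf hfC) (integrable_of_abs_le hg hgC), noise, noise]
    ring
  have h1 := hM.abs_feature_dotProduct_le zero_le_two (by linarith : u ⬝ᵥ u ≤ 2 ^ 2) (ω h)
  have h2 : |(f (ω ⟨h + 1, hh⟩).1 - g (ω ⟨h + 1, hh⟩).1) - ∫ s, (f s - g s) ∂M.P h (ω h)|
      ≤ η + η := (abs_sub _ _).trans (add_le_add (hfg _) (abs_integral_le_of_abs_le hfg))
  have h3 := (le_abs_self _).trans_eq (abs_mul ((φ (ω h)).ofLp ⬝ᵥ u)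
      ((f (ω ⟨h + 1, hh⟩).1 - g (ω ⟨h + 1, hh⟩).1) - ∫ s, (f s - g s) ∂M.P h (ω h)))
  rw [← e] at h3
  have h4 := mul_le_mul h1 h2 (abs_nonneg _) zero_le_two
  linarith

variable [Fintype A] [MeasurableSingletonClass A] [Fintype B] [MeasurableSingletonClass B]
  [Nonempty A] [Nonempty B]

/-- Tests the noise vector `v` against a rounding `u₀` of its own direction `u`. As `u - u₀` has
norm at most `1 / 2`, half of the norm of `v` survives in `v ⬝ᵥ u₀`, whence the factor `2`. Rounding
`w` and `L` changes the noise of each episode by at most four times the modulus of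
`abs_bonusValue_sub_le`. -/
theorem sqrt_noiseVec_le (hM : IsLinear M φ) {G : Finset ℝ} {R δ : ℝ} (hR : 1 ≤ R)
    (hG : ∀ y : ℝ, |y| ≤ R → ∃ g ∈ G, |y - g| ≤ δ) (hδ0 : 0 ≤ δ) (hδ : d * δ ≤ 1 / 4)
    {b β t : ℝ} (hb : |b| ≤ β) (ht : 0 ≤ t) (h : Fin H) (hh : (h : ℕ) + 1 < H)
    (ω : Fin K → Fin H → S × A × B)
    (hgood : ∀ (u w : Fin d → G) (L : Fin d → Fin d → G),
      (fun i => (u i : ℝ)) ⬝ᵥ (fun i => (u i : ℝ)) ≤ 4 →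
        ∑ τ, noise M φ (bonusValue φ ((H : ℝ) - ((h : ℕ) + 1 : ℕ)) b (fun i => (w i : ℝ))
          (fun i j => (L i j : ℝ))) (fun i => (u i : ℝ)) h hh (ω τ) ≤ t)
    {w : Fin d → ℝ} {L : Matrix (Fin d) (Fin d) ℝ} (hw : ∀ i, |w i| ≤ R)
    (hL : ∀ i j, |L i j| ≤ R) :
    √(noiseVec M φ (bonusValue φ ((H : ℝ) - ((h : ℕ) + 1 : ℕ)) b w L) h hh ω ⬝ᵥ
      noiseVec M φ (bonusValue φ ((H : ℝ) - ((h : ℕ) + 1 : ℕ)) b w L) h hh ω) ≤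
      2 * (t + K * (4 * (d * δ + β * √(d ^ 2 * δ)))) := by
  set m : ℝ := (H : ℝ) - ((h : ℕ) + 1 : ℕ)
  have hm : 0 ≤ m := sub_nonneg.2 (by exact_mod_cast hh.le)
  set f := bonusValue φ m b w L with hf
  set v := noiseVec M φ f h hh ω with hv
  set N := √(v ⬝ᵥ v) with hN
  have hN2 : N * N = v ⬝ᵥ v := Real.mul_self_sqrt (zero_le_dotProduct_self v)
  have hβ : 0 ≤ β := (abs_nonneg _).trans hb
  rcases (Real.sqrt_nonneg (v ⬝ᵥ v)).eq_or_lt with h0 | h0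
  · rw [hN, ← h0]; positivity
  change 0 < N at h0
  set u : Fin d → ℝ := N⁻¹ • v with hu
  have huu : u ⬝ᵥ u = 1 := by
    rw [hu, smul_dotProduct, dotProduct_smul, ← hN2, smul_eq_mul, smul_eq_mul]
    field_simp
  have hvu : v ⬝ᵥ u = N := by
    rw [hu, dotProduct_smul, ← hN2, smul_eq_mul]
    field_simp
  have hui : ∀ i, |u i| ≤ 1 := fun i => by
    refine abs_le_one_iff_mul_self_le_one.2 ?_
    rw [← huu]
    exact Finset.single_le_sum (f := fun i => u i * u i) (fun i _ => mul_self_nonneg _)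
      (Finset.mem_univ i)
  choose u₀ hu₀G hu₀ using fun i => hG (u i) ((hui i).trans hR)
  choose w₀ hw₀G hw₀ using fun i => hG (w i) (hw i)
  choose L₀ hL₀G hL₀ using fun i j => hG (L i j) (hL i j)
  have hei : ∀ i, |(u - u₀) i| ≤ δ := hu₀
  have hdδ : 0 ≤ d * δ := by positivity
  have hee : (u - u₀) ⬝ᵥ (u - u₀) ≤ 1 / 4 := by
    rcases Nat.eq_zero_or_pos d with hd | hd
    · subst hd
      simp
    · have hδ1 : δ ≤ 1 := by
        have : (1 : ℝ) ≤ d := by exact_mod_cast hd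
        nlinarith
      exact (le_abs_self _).trans
        ((abs_dotProduct_le_of_abs_le (fun i => (hei i).trans hδ1) hei).trans hδ)
  have hue : |u ⬝ᵥ (u - u₀)| ≤ 1 / 4 := (abs_dotProduct_le_of_abs_le hui hei).trans hδ
  have hu4 : u₀ ⬝ᵥ u₀ ≤ 4 := by
    have e : u₀ ⬝ᵥ u₀ = u ⬝ᵥ u - 2 * (u ⬝ᵥ (u - u₀)) + (u - u₀) ⬝ᵥ (u - u₀) := by
      simp only [dotProduct_sub, sub_dotProduct]
      rw [dotProduct_comm u₀ u]
      ring
    rw [e, huu]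
    linarith [(abs_le.1 hue).1]
  have hve : |v ⬝ᵥ (u - u₀)| ≤ N * (1 / 2) := by
    refine (abs_dotProduct_le _ _).trans (mul_le_mul_of_nonneg_left ?_ h0.le)
    exact Real.sqrt_le_iff.2 ⟨by norm_num, hee.trans (by norm_num)⟩
  rw [dotProduct_sub, hvu] at hve
  have hmain : v ⬝ᵥ u₀ ≤ t + K * (4 * (d * δ + β * √(d ^ 2 * δ))) := by
    have hI := bonusValue_mem_Icc φ hm b
    have hA : ∀ w L s, |bonusValue φ m b w L s| ≤ m := fun w L s =>
      abs_le.2 ⟨by linarith [(hI w L s).1], (hI w L s).2⟩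
    have hmeas := measurable_bonusValue hM.measurable_feature m b
    rw [hv, noiseVec_dotProduct]
    calc ∑ τ, noise M φ f u₀ h hh (ω τ)
        ≤ ∑ τ, (noise M φ (bonusValue φ m b w₀ L₀) u₀ h hh (ω τ) +
            4 * (d * δ + β * √(d ^ 2 * δ))) :=
          Finset.sum_le_sum fun τ _ => noise_le_add hM (hmeas _ _) (hmeas _ _) (hA _ _) (hA _ _)
            (abs_bonusValue_sub_le hM.abs_feature_apply_le hb hw₀ hL₀) hu4 h hh (ω τ)
      _ ≤ t + K * (4 * (d * δ + β * √(d ^ 2 * δ))) := by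
          rw [Finset.sum_add_distrib]
          simp only [Finset.sum_const, Finset.card_univ, Fintype.card_fin, nsmul_eq_mul]
          exact add_le_add_left (hgood (fun i => ⟨u₀ i, hu₀G i⟩) (fun i => ⟨w₀ i, hw₀G i⟩)
            (fun i j => ⟨L₀ i j, hL₀G i j⟩) hu4) _
  linarith [(abs_le.1 hve).2]

end Discretization

/-! ### One step of regression on the recorded data -/

section Regression

open Matrix

variable {S A B : Type*} [MeasurableSpace S] [MeasurableSpace A] [MeasurableSpace B] {d H K : ℕ}
  {M : MarkovGame S A B H} {φ : S × A × B → EuclideanSpace ℝ (Fin d)}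

theorem gram_record (ω : Fin K → Fin H → S × A × B) (h : Fin H) :
    gram φ (record M ω) h =
      ∑ τ, vecMulVec (φ (ω τ h)).ofLp (φ (ω τ h)).ofLp + 1 := rfl

theorem dotProduct_self_le_gram (ω : Fin K → Fin H → S × A × B) (h : Fin H) (x : Fin d → ℝ) :
    1 * (x ⬝ᵥ x) ≤ x ⬝ᵥ gram φ (record M ω) h *ᵥ x := by
  rw [gram_record, dotProduct_gram_mulVec, one_mul]
  exact le_add_of_nonneg_left (Finset.sum_nonneg fun τ _ => sq_nonneg _)

/-- Entrywise deviations of `K * c / (2 * d)` perturb the quadratic form by at most that times `(∑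
|v i|)² ≤ d (v ⬝ᵥ v)`, hence lose only half of `K * c`. -/
theorem IsLinear.le_gram_of_cov {π : Policy S A} {ν : Policy S B} {x : S} {c : ℝ} (hc : 0 < c)
    (hd : 0 < d) {h : Fin H} (hcov : c ≤ lambdaMin (featureCov M φ π ν x h))
    {ω : Fin K → Fin H → S × A × B}
    (hω : ∀ i j, |∑ τ, (φ (ω τ h) i * φ (ω τ h) j - featureCov M φ π ν x h i j)| ≤
      K * (c / (2 * d))) (v : Fin d → ℝ) :
    K * c / 2 * (v ⬝ᵥ v) ≤ v ⬝ᵥ gram φ (record M ω) h *ᵥ v := by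
  have hd' : (0 : ℝ) < d := by exact_mod_cast hd
  rw [gram_record, dotProduct_gram_mulVec]
  have h1 := mul_dotProduct_le_of_le_lambdaMin (isHermitian_featureCov M φ π ν x h) hcov v
  have h2 : ∑ τ, ((φ (ω τ h)).ofLp ⬝ᵥ v) ^ 2 - K * (v ⬝ᵥ featureCov M φ π ν x h *ᵥ v) =
      ∑ i, ∑ j, v i * v j *
        ∑ τ, (φ (ω τ h) i * φ (ω τ h) j - featureCov M φ π ν x h i j) := by
    have e1 : ∀ τ, ((φ (ω τ h)).ofLp ⬝ᵥ v) ^ 2 =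
        ∑ i, ∑ j, v i * v j * (φ (ω τ h) i * φ (ω τ h) j) := fun τ => by
      rw [sq, dotProduct, Finset.sum_mul_sum]
      refine Finset.sum_congr rfl fun i _ => Finset.sum_congr rfl fun j _ => ?_
      ring
    have e2 : v ⬝ᵥ featureCov M φ π ν x h *ᵥ v =
        ∑ i, ∑ j, v i * v j * featureCov M φ π ν x h i j := by
      simp only [dotProduct, mulVec, Finset.mul_sum]
      refine Finset.sum_congr rfl fun i _ => Finset.sum_congr rfl fun j _ => ?_
      ring
    simp only [e1, e2, Finset.sum_sub_distrib, mul_sub, Finset.sum_const, Finset.card_univ,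
      Fintype.card_fin, nsmul_eq_mul]
    congr 1
    · rw [Finset.sum_comm]
      refine Finset.sum_congr rfl fun i _ => ?_
      rw [Finset.sum_comm]
      refine Finset.sum_congr rfl fun j _ => ?_
      rw [Finset.mul_sum]
    · rw [Finset.mul_sum]
      refine Finset.sum_congr rfl fun i _ => ?_
      rw [Finset.mul_sum]
      refine Finset.sum_congr rfl fun j _ => ?_
      ring
  have h3 : |∑ i, ∑ j, v i * v j *
        ∑ τ, (φ (ω τ h) i * φ (ω τ h) j - featureCov M φ π ν x h i j)| ≤
      K * c / 2 * (v ⬝ᵥ v) := by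
    calc _ ≤ ∑ i, ∑ j, |v i| * |v j| * (K * (c / (2 * d))) := by
          refine (Finset.abs_sum_le_sum_abs _ _).trans (Finset.sum_le_sum fun i _ => ?_)
          refine (Finset.abs_sum_le_sum_abs _ _).trans (Finset.sum_le_sum fun j _ => ?_)
          rw [abs_mul, abs_mul]
          exact mul_le_mul_of_nonneg_left (hω i j) (by positivity)
      _ = (∑ i, |v i|) ^ 2 * (K * (c / (2 * d))) := by
          rw [sq, Finset.sum_mul_sum]
          simp only [Finset.sum_mul]
      _ ≤ (d * (v ⬝ᵥ v)) * (K * (c / (2 * d))) := by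
          refine mul_le_mul_of_nonneg_right ?_ (by positivity)
          have := sq_sum_le_card_mul_sum_sq (s := Finset.univ) (f := fun i => |v i|)
          simpa [dotProduct, sq] using this
      _ = K * c / 2 * (v ⬝ᵥ v) := by field_simp
  have h4 : K * (c * (v ⬝ᵥ v)) ≤ K * (v ⬝ᵥ featureCov M φ π ν x h *ᵥ v) :=
    mul_le_mul_of_nonneg_left h1 (Nat.cast_nonneg _)
  have h5 := zero_le_dotProduct_self v
  have h6 := (abs_le.1 h3).1
  rw [← h2] at h6
  nlinarith

theorem nextValue_record (ω : Fin K → Fin H → S × A × B) (V : S → ℝ) (τ : Fin K) (h : Fin H)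
    (hh : (h : ℕ) + 1 < H) :
    nextValue (record M ω) V τ h = V (ω τ ⟨h + 1, hh⟩).1 := by
  rw [nextValue, dif_pos hh]
  rfl

theorem ridge_record (ω : Fin K → Fin H → S × A × B) (V : S → ℝ) (h : Fin H) :
    ridge φ (record M ω) V h = (gram φ (record M ω) h)⁻¹ *ᵥ
      (∑ τ, (M.r h (ω τ h) + nextValue (record M ω) V τ h) • (φ (ω τ h)).ofLp) := rfl

/-- A crude bound from `Λ ≥ 1` alone, valid for every dataset; it keeps the weights within the range
of the grid. -/
theorem IsLinear.abs_ridge_apply_le (hM : IsLinear M φ) (ω : Fin K → Fin H → S × A × B)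
    (h : Fin H) {V : S → ℝ} (hV : ∀ s, V s ∈ Set.Icc (0 : ℝ) ((H : ℝ) - ((h : ℕ) + 1 : ℕ)))
    (i : Fin d) : |ridge φ (record M ω) V h i| ≤ K * H := by
  have hy : ∀ τ, |M.r h (ω τ h) + nextValue (record M ω) V τ h| ≤ H := fun τ => by
    have hr := M.r_mem h h.2 (ω τ h)
    have hH : ((h : ℕ) : ℝ) + 1 ≤ H := by exact_mod_cast h.2
    have h0 : (0 : ℝ) ≤ (h : ℕ) := Nat.cast_nonneg _
    by_cases hh : (h : ℕ) + 1 < H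
    · rw [nextValue_record ω V τ h hh]
      have := hV (ω τ ⟨h + 1, hh⟩).1
      push_cast at this
      exact abs_le.2 ⟨by linarith [this.1, hr.1], by linarith [this.2, hr.2]⟩
    · rw [nextValue, dif_neg hh]
      exact abs_le.2 ⟨by linarith [hr.1], by linarith [hr.2]⟩
  have e : ridge φ (record M ω) V h i = ∑ τ, (M.r h (ω τ h) + nextValue (record M ω) V τ h) *
      (Pi.single i 1 ⬝ᵥ (gram φ (record M ω) h)⁻¹ *ᵥ (φ (ω τ h)).ofLp) := by
    rw [ridge_record, mulVec_sum]
    simp only [mulVec_smul, Finset.sum_apply, Pi.smul_apply, smul_eq_mul,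
      single_one_dotProduct]
  rw [e]
  refine (Finset.abs_sum_le_sum_abs _ _).trans ?_
  refine (Finset.sum_le_sum (g := fun _ => (H : ℝ)) fun τ _ => ?_).trans (by simp)
  rw [abs_mul]
  refine (mul_le_mul (hy τ) (d := 1) ?_ (abs_nonneg _) (Nat.cast_nonneg _)).trans_eq (mul_one _)
  refine (abs_dotProduct_inv_mulVec_le one_pos (dotProduct_self_le_gram ω h) _ _).trans ?_
  have h1 := Real.sqrt_le_one.2 (hM.feature_dotProduct_self_le (ω τ h))
  simpa using h1

theorem bellman_mem_Icc {h : ℕ} (hh : h < H) {V : S → ℝ} (hV : Measurable V) {m : ℝ}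
    (hm : ∀ s, V s ∈ Set.Icc 0 m) (z : S × A × B) :
    bellman M h V z ∈ Set.Icc 0 (m + 1) := by
  have hr := M.r_mem h hh z
  have h0 : 0 ≤ ∫ y, V y ∂M.P h z := integral_nonneg fun y => (hm y).1
  have h1 : ∫ y, V y ∂M.P h z ≤ m := by
    have := integral_mono (μ := M.P h z) (integrable_of_abs_le hV (C := m)
      fun y => abs_le.2 ⟨by linarith [(hm y).1, (hm y).2], (hm y).2⟩) (integrable_const m)
      fun y => (hm y).2
    simpa using this
  exact ⟨add_nonneg hr.1 h0, by unfold bellman; linarith [hr.2]⟩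

/-- The accuracy of one step of truncated ridge regression with an elliptical bonus. -/
theorem IsLinear.abs_bonusQ_sub_bellman_le (hM : IsLinear M φ) {π : Policy S A} {ν : Policy S B}
    {x : S} {c : ℝ} (hc : 0 < c) {h : Fin H} (hcov : c ≤ lambdaMin (featureCov M φ π ν x h))
    {ω : Fin K → Fin H → S × A × B} {κ : ℝ} (hκ : 0 < κ)
    (hgram : ∀ v, κ * (v ⬝ᵥ v) ≤ v ⬝ᵥ gram φ (record M ω) h *ᵥ v) {V : S → ℝ}
    (hV : Measurable V) (hVm : ∀ s, V s ∈ Set.Icc (0 : ℝ) ((H : ℝ) - ((h : ℕ) + 1 : ℕ)))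
    {T : ℝ} (hT0 : 0 ≤ T) (hT : ∀ hh : (h : ℕ) + 1 < H,
      √(noiseVec M φ V h hh ω ⬝ᵥ noiseVec M φ V h hh ω) ≤ T)
    {b β : ℝ} (hb : |b| ≤ β) (s : S) (a : A) (a' : B) :
    |bonusQ φ ((H : ℝ) - (h : ℕ)) b (ridge φ (record M ω) V h) (gram φ (record M ω) h)⁻¹ s a a' -
      bellman M h V (s, a, a')| ≤ (T + H / √c) / κ + β / √κ := by
  have hVC : ∀ s, |V s| ≤ (H : ℝ) - ((h : ℕ) + 1 : ℕ) := fun s =>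
    abs_le.2 ⟨by linarith [(hVm s).1, (hVm s).2], (hVm s).2⟩
  have hbell := bellman_mem_Icc (M := M) h.2 hV hVm
  have em : (H : ℝ) - ((h : ℕ) + 1 : ℕ) + 1 = (H : ℝ) - (h : ℕ) := by push_cast; ring
  rw [em] at hbell
  obtain ⟨w, hw⟩ := hM.exists_weight h.2 hV hVC
  have hβ : 0 ≤ β := (abs_nonneg _).trans hb
  have hww : √(w ⬝ᵥ w) ≤ H / √c := by
    have h1 := hM.mul_weight_le hcov (w := w) (m := H) fun z => by
      rw [← hw z]
      have h0 : (0 : ℝ) ≤ (h : ℕ) := Nat.cast_nonneg _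
      exact abs_le.2 ⟨by linarith [(hbell z).1, (hbell z).2], by linarith [(hbell z).2]⟩
    refine Real.sqrt_le_iff.2 ⟨by positivity, ?_⟩
    rw [div_pow, Real.sq_sqrt hc.le, le_div_iff₀ hc]
    linarith
  have hsum : ∑ τ, (M.r h (ω τ h) + nextValue (record M ω) V τ h - (φ (ω τ h)).ofLp ⬝ᵥ w) •
      (φ (ω τ h)).ofLp = if hh : (h : ℕ) + 1 < H then noiseVec M φ V h hh ω else 0 := by
    split_ifs with hh
    · refine Finset.sum_congr rfl fun τ _ => ?_
      rw [nextValue_record ω V τ h hh, ← hw, bellman, add_sub_add_left_eq_sub]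
    -- At the last step `V` takes values in `[0, 0]`, so the response is exactly the reward and
    -- there is no noise.
    · refine Finset.sum_eq_zero fun τ _ => ?_
      have hH : H = (h : ℕ) + 1 := by have := h.2; omega
      have hV0 : ∀ s, V s = 0 := fun s => by
        have := hVm s
        have e : (H : ℝ) - ((h : ℕ) + 1 : ℕ) = 0 := sub_eq_zero.2 (by exact_mod_cast hH)
        rw [e] at this
        exact le_antisymm this.2 this.1
      rw [nextValue, dif_neg hh, ← hw, bellman]
      simp [hV0]
  have hnoise : √((∑ τ, (M.r h (ω τ h) + nextValue (record M ω) V τ h -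
      (φ (ω τ h)).ofLp ⬝ᵥ w) • (φ (ω τ h)).ofLp) ⬝ᵥ
      (∑ τ, (M.r h (ω τ h) + nextValue (record M ω) V τ h -
      (φ (ω τ h)).ofLp ⬝ᵥ w) • (φ (ω τ h)).ofLp)) ≤ T := by
    rw [hsum]
    split_ifs with hh
    · exact hT hh
    · simpa using hT0
  set v := (φ (s, a, a')).ofLp with hv
  have hvv : v ⬝ᵥ v ≤ 1 := hM.feature_dotProduct_self_le _
  have hreg := abs_dotProduct_ridge_sub_le (fun τ => (φ (ω τ h)).ofLp) hκ hgram
    (fun τ => M.r h (ω τ h) + nextValue (record M ω) V τ h) w v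
  -- Truncation does not increase the error, because the Bellman image already lies in the
  -- truncation interval.
  refine (abs_clip_sub_le (hbell _)).trans ?_
  rw [hw, ← hv, add_sub_right_comm]
  refine (abs_add_le _ _).trans (add_le_add ?_ ?_)
  · refine hreg.trans (div_le_div_of_nonneg_right ?_ hκ.le)
    refine (mul_le_mul (Real.sqrt_le_one.2 hvv) (add_le_add hnoise hww) (by positivity)
      zero_le_one).trans_eq (one_mul _)
  · rw [abs_mul, abs_of_nonneg (Real.sqrt_nonneg _), div_eq_mul_inv]
    refine mul_le_mul hb ?_ (Real.sqrt_nonneg _) hβ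
    rw [← Real.sqrt_inv]
    refine Real.sqrt_le_sqrt ?_
    refine (le_abs_self _).trans ((abs_dotProduct_inv_mulVec_le hκ hgram v v).trans ?_)
    rw [Real.mul_self_sqrt (zero_le_dotProduct_self v), ← one_div]
    exact div_le_div_of_nonneg_right hvv hκ.le

end Regression

/-! ### Accuracy of a complete run -/

section Run

open Matrix

variable {S A B : Type*} [MeasurableSpace S] [MeasurableSpace A] [MeasurableSpace B] {d H K : ℕ}
  {M : MarkovGame S A B H} {φ : S × A × B → EuclideanSpace ℝ (Fin d)}
  [Fintype A] [MeasurableSingletonClass A] [Fintype B] [MeasurableSingletonClass B]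
  [Nonempty A] [Nonempty B]

theorem IsLinear.value_iteration_accuracy (hM : IsLinear M φ) {π : Policy S A} {ν : Policy S B}
    {x : S} {c : ℝ} (hc : 0 < c) (hcov : ∀ h, c ≤ lambdaMin (featureCov M φ π ν x h))
    {ω : Fin K → Fin H → S × A × B} {κ : ℝ} (hκ : 0 < κ)
    (hgram : ∀ h v, κ * (v ⬝ᵥ v) ≤ v ⬝ᵥ gram φ (record M ω) h *ᵥ v) {T R b β : ℝ} (hT0 : 0 ≤ T)
    (hR1 : 1 ≤ R) (hR : K * H ≤ R) (hb : |b| ≤ β)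
    (hT : ∀ (h : Fin H) (hh : (h : ℕ) + 1 < H) (w : Fin d → ℝ) (L : Matrix (Fin d) (Fin d) ℝ),
      (∀ i, |w i| ≤ R) → (∀ i j, |L i j| ≤ R) →
      √(noiseVec M φ (bonusValue φ ((H : ℝ) - ((h : ℕ) + 1 : ℕ)) b w L) h hh ω ⬝ᵥ
        noiseVec M φ (bonusValue φ ((H : ℝ) - ((h : ℕ) + 1 : ℕ)) b w L) h hh ω) ≤ T)
    {V : ℕ → S → ℝ} (hVH : ∀ s, V H s = 0)
    (hV : ∀ (h : Fin H) s, V h s = bonusValue φ ((H : ℝ) - (h : ℕ)) b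
      (ridge φ (record M ω) (V (h + 1)) h) (gram φ (record M ω) h)⁻¹ s) :
    (∀ h ≤ H, Measurable (V h)) ∧ (∀ h ≤ H, ∀ s, |V h s| ≤ H) ∧
    ∀ (h : Fin H) s a a', |bonusQ φ ((H : ℝ) - (h : ℕ)) b (ridge φ (record M ω) (V (h + 1)) h)
      (gram φ (record M ω) h)⁻¹ s a a' - bellman M h (V (h + 1)) (s, a, a')| ≤
      (T + H / √c) / κ + β / √κ := by
  have hV' : ∀ h : Fin H, V h = bonusValue φ ((H : ℝ) - (h : ℕ)) b
      (ridge φ (record M ω) (V (h + 1)) h) (gram φ (record M ω) h)⁻¹ := fun h => funext (hV h)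
  have hmeas : ∀ h ≤ H, Measurable (V h) := by
    intro h hh
    rcases hh.eq_or_lt with rfl | hlt
    · have : V h = fun _ => 0 := funext hVH
      rw [this]
      exact measurable_const
    · rw [hV' ⟨h, hlt⟩]
      exact measurable_bonusValue hM.measurable_feature _ _ _ _
  have hmem : ∀ h ≤ H, ∀ s, V h s ∈ Set.Icc (0 : ℝ) ((H : ℝ) - (h : ℕ)) := by
    intro h hh s
    have h0 : (0 : ℝ) ≤ (H : ℝ) - (h : ℕ) := sub_nonneg.2 (by exact_mod_cast hh)
    rcases hh.eq_or_lt with rfl | hlt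
    · rw [hVH]
      exact ⟨le_rfl, h0⟩
    · rw [hV' ⟨h, hlt⟩]
      exact bonusValue_mem_Icc φ h0 _ _ _ s
  refine ⟨hmeas, fun h hh s => ?_, fun h s a a' => ?_⟩
  · have h0 : (0 : ℝ) ≤ h := Nat.cast_nonneg _
    exact abs_le.2 ⟨by linarith [(hmem h hh s).1, (hmem h hh s).2],
      by linarith [(hmem h hh s).2]⟩
  · refine hM.abs_bonusQ_sub_bellman_le hc (hcov h) hκ (hgram h) (hmeas _ h.2) (hmem _ h.2) hT0
      (fun hh => ?_) hb s a a'
    -- The next value function is itself in the family, with weight and matrix read off the data at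
    -- step `h + 1`, so the uniform noise bound applies to it.
    rw [hV' ⟨h + 1, hh⟩]
    refine hT h hh _ _ (fun i => (hM.abs_ridge_apply_le ω ⟨h + 1, hh⟩ (hmem _ hh) i).trans hR)
      fun i j => ?_
    exact (abs_inv_apply_le one_pos (dotProduct_self_le_gram ω ⟨h + 1, hh⟩) i j).trans
      (by simpa using hR1)

theorem IsLinear.dualityGap_le_of_isPMVIOutput (hM : IsLinear M φ) {π : Policy S A}
    {ν : Policy S B} {x : S} {c : ℝ} (hc : 0 < c)
    (hcov : ∀ h, c ≤ lambdaMin (featureCov M φ π ν x h))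
    {ω : Fin K → Fin H → S × A × B} {κ : ℝ} (hκ : 0 < κ)
    (hgram : ∀ h v, κ * (v ⬝ᵥ v) ≤ v ⬝ᵥ gram φ (record M ω) h *ᵥ v) {T R β : ℝ} (hT0 : 0 ≤ T)
    (hR1 : 1 ≤ R) (hR : K * H ≤ R) (hβ : 0 ≤ β)
    (hT : ∀ (σ : Bool) (h : Fin H) (hh : (h : ℕ) + 1 < H) (w : Fin d → ℝ)
      (L : Matrix (Fin d) (Fin d) ℝ), (∀ i, |w i| ≤ R) → (∀ i j, |L i j| ≤ R) →
      √(noiseVec M φ (bonusValue φ ((H : ℝ) - ((h : ℕ) + 1 : ℕ)) (bif σ then β else -β) w L) h hh ω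
        ⬝ᵥ noiseVec M φ (bonusValue φ ((H : ℝ) - ((h : ℕ) + 1 : ℕ)) (bif σ then β else -β) w L)
        h hh ω) ≤ T) {piHat : Policy S A} {nuHat : Policy S B}
    (hout : IsPMVIOutput φ β (record M ω) piHat nuHat) :
    dualityGap M piHat nuHat x ≤ 4 * H * ((T + H / √c) / κ + β / √κ) := by
  obtain ⟨piPrime, nuPrime, Vlow, Vup, hlH, huH, hrun⟩ := hout
  obtain ⟨hlm, hlC, hlQ⟩ := hM.value_iteration_accuracy hc hcov hκ hgram hT0 hR1 hR (b := -β)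
    (β := β) (by rw [abs_neg, abs_of_nonneg hβ]) (hT false) hlH (fun h s => by
      obtain ⟨hN, -, e, -⟩ := hrun h s
      rw [e, hN.payoff_eq_gameValue, lowerQ_eq_bonusQ, bonusValue])
  obtain ⟨hum, huC, huQ⟩ := hM.value_iteration_accuracy hc hcov hκ hgram hT0 hR1 hR (b := β)
    (β := β) (by rw [abs_of_nonneg hβ]) (hT true) huH (fun h s => by
      obtain ⟨-, hN, -, e⟩ := hrun h s
      rw [e, hN.payoff_eq_gameValue, upperQ_eq_bonusQ, bonusValue])
  refine dualityGap_le (V := Vup) (W := Vlow) (π' := piPrime) (ν' := nuPrime)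
    (Q := fun h s a b => if hh : h < H then
      upperQ φ β (record M ω) (Vup (h + 1)) ⟨h, hh⟩ s a b else 0)
    (R := fun h s a b => if hh : h < H then
      lowerQ φ β (record M ω) (Vlow (h + 1)) ⟨h, hh⟩ s a b else 0)
    hum hlm huC hlC huH hlH (fun h hh s => ?_) (fun h hh s => ?_) (fun h hh s a b => ?_)
    (fun h hh s a b => ?_) x
  · simp only [dif_pos hh]
    exact ⟨(hrun ⟨h, hh⟩ s).2.1, (hrun ⟨h, hh⟩ s).2.2.2⟩
  · simp only [dif_pos hh]
    exact ⟨(hrun ⟨h, hh⟩ s).1, (hrun ⟨h, hh⟩ s).2.2.1⟩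
  · simp only [dif_pos hh, upperQ_eq_bonusQ]
    exact huQ ⟨h, hh⟩ s a b
  · simp only [dif_pos hh, lowerQ_eq_bonusQ]
    exact hlQ ⟨h, hh⟩ s a b

end Run

/-! ### Numerical estimates -/

section Rates

/-- The union bound over a grid with at most `K ^ 9` points. -/
theorem union_bound_le {d H K N : ℕ} {p : ℝ} (hd : 0 < d) (hH : 0 < H) (hK : 0 < K) (hp : 0 < p)
    (hp1 : p < 1) (hN : N ≤ K ^ 9) :
    H * 2 * (N : ℝ) ^ (d + d + d * d) *
      Real.exp (-(15 * d * H * (√K * √(Real.log (4 * d * H * K / p)))) ^ 2 / (8 * (K * H ^ 2))) ≤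
      p / 2 := by
  have hd' : (1 : ℝ) ≤ d := by exact_mod_cast hd
  have hH' : (1 : ℝ) ≤ H := by exact_mod_cast hH
  have hK' : (1 : ℝ) ≤ K := by exact_mod_cast hK
  set q : ℝ := 4 * d * H * K / p with hq
  have hdHK : (1 : ℝ) ≤ d * H * K := one_le_mul_of_one_le_of_one_le
    (one_le_mul_of_one_le_of_one_le hd' hH') hK'
  have hqK : (K : ℝ) ≤ q := by
    rw [hq, le_div_iff₀ hp]
    have : (1 : ℝ) ≤ d * H := one_le_mul_of_one_le_of_one_le hd' hH'
    nlinarith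
  have hq1 : 1 ≤ q := hK'.trans hqK
  have hq0 : 0 < q := one_pos.trans_le hq1
  set ζ := Real.log q with hζ
  have hζ0 : 0 ≤ ζ := Real.log_nonneg hq1
  -- The constant `15` is chosen so that `15² / 8 ≥ 28`. The grid costs `q ^ (27 * d ^ 2)`, from `9
  -- * (d + d + d * d) ≤ 27 * d ^ 2`, and the surplus `q ^ (-d ^ 2) ≤ q⁻¹` absorbs `2 * H`.
  have hexp : Real.exp (-(15 * d * H * (√K * √ζ)) ^ 2 / (8 * (K * H ^ 2))) ≤
      (q ^ (28 * d ^ 2))⁻¹ := by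
    have e : (15 * d * H * (√K * √ζ)) ^ 2 = 225 * d ^ 2 * H ^ 2 * (K * ζ) := by
      rw [mul_pow, mul_pow √(K : ℝ), Real.sq_sqrt (Nat.cast_nonneg K), Real.sq_sqrt hζ0]
      ring
    have e2 : -(225 * (d : ℝ) ^ 2 * H ^ 2 * (K * ζ)) / (8 * (K * H ^ 2)) =
        -(225 / 8 * (d ^ 2 * ζ)) := by
      field_simp
    have e3 : (q ^ (28 * d ^ 2))⁻¹ = Real.exp (-(28 * (d ^ 2 * ζ))) := by
      rw [Real.exp_neg, ← Real.exp_log hq0, ← Real.exp_nat_mul, ← hζ]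
      push_cast
      rw [mul_assoc]
    rw [e, e2, e3]
    refine Real.exp_le_exp.2 (neg_le_neg ?_)
    have : 0 ≤ (d : ℝ) ^ 2 * ζ := by positivity
    linarith
  have hcard : (N : ℝ) ^ (d + d + d * d) ≤ q ^ (27 * d ^ 2) := by
    have h1 : (N : ℝ) ≤ q ^ 9 := by
      have : (N : ℝ) ≤ (K : ℝ) ^ 9 := by exact_mod_cast hN
      exact this.trans (pow_le_pow_left₀ (Nat.cast_nonneg K) hqK 9)
    refine (pow_le_pow_left₀ (Nat.cast_nonneg N) h1 _).trans ?_
    rw [← pow_mul]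
    refine pow_le_pow_right₀ hq1 ?_
    nlinarith
  have hlast : q ^ (27 * d ^ 2) * (q ^ (28 * d ^ 2))⁻¹ ≤ q⁻¹ := by
    have h1 : q ^ (28 * d ^ 2) = q ^ (27 * d ^ 2) * q ^ (d ^ 2) := by
      rw [← pow_add]
      congr 1
      ring
    rw [h1, mul_inv, mul_inv_cancel_left₀ (by positivity)]
    refine inv_anti₀ hq0 ?_
    exact le_self_pow₀ hq1 (by positivity)
  calc _ ≤ H * 2 * q ^ (27 * d ^ 2) * (q ^ (28 * d ^ 2))⁻¹ := by gcongr
    _ ≤ H * 2 * q⁻¹ := by rw [mul_assoc]; gcongr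
    _ = p / 2 / (d * K) := by
      rw [hq]
      field_simp
      norm_num
    _ ≤ p / 2 := div_le_self (by positivity) (one_le_mul_of_one_le_of_one_le hd' hK')

/-- The crude bound `exp (-y) ≤ 1 / y` is enough, as the threshold on `K` may depend on `p`. -/
theorem cov_union_bound_le {d H K : ℕ} {p η : ℝ} (hp : 0 < p) (hη : 0 < η) (hK0 : 0 < K)
    (hK : 32 * H * d ^ 2 / (p * η ^ 2) ≤ K) :
    H * 2 * (d : ℝ) ^ 2 * Real.exp (-(K * η ^ 2) / 8) ≤ p / 2 := by
  have hK' : (0 : ℝ) < K := by exact_mod_cast hK0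
  have h1 : Real.exp (-(K * η ^ 2) / 8) ≤ 8 / (K * η ^ 2) := by
    rw [neg_div, Real.exp_neg, ← one_div, div_le_div_iff₀ (Real.exp_pos _) (by positivity)]
    linarith [Real.add_one_le_exp (K * η ^ 2 / 8)]
  refine (mul_le_mul_of_nonneg_left h1 (by positivity)).trans ?_
  rw [div_le_iff₀ (by positivity)] at hK
  rw [← mul_div_assoc, div_le_div_iff₀ (by positivity) two_pos]
  linarith

theorem discretization_error_le {d K : ℕ} {β : ℝ} (hK : 3 ≤ K) (hd : 4 * d ≤ K)
    (hβ : β ≤ K) :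
    K * (4 * (d * (1 / (K : ℝ) ^ 6) + β * √(d ^ 2 * (1 / (K : ℝ) ^ 6)))) ≤ 2 := by
  have hK' : (3 : ℝ) ≤ K := by exact_mod_cast hK
  have hK0 : (0 : ℝ) < K := by linarith
  have hd' : 4 * (d : ℝ) ≤ K := by exact_mod_cast hd
  have e : √((d : ℝ) ^ 2 * (1 / (K : ℝ) ^ 6)) = d / K ^ 3 := by
    rw [show (d : ℝ) ^ 2 * (1 / (K : ℝ) ^ 6) = (d / K ^ 3) ^ 2 by field_simp,
      Real.sqrt_sq (by positivity)]
  rw [e]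
  have h1 : β * (d / (K : ℝ) ^ 3) ≤ 1 / (4 * K) := by
    rw [← mul_div_assoc, div_le_div_iff₀ (by positivity) (by positivity)]
    calc β * d * (4 * K) = β * (4 * d) * K := by ring
      _ ≤ K * K * K := by gcongr
      _ = 1 * K ^ 3 := by ring
  have h2 : d * (1 / (K : ℝ) ^ 6) ≤ 1 / (4 * K) := by
    rw [mul_one_div, div_le_div_iff₀ (by positivity) (by positivity)]
    have h3 : (K : ℝ) ^ 2 ≤ K ^ 6 := pow_le_pow_right₀ (by linarith) (by norm_num)
    nlinarith
  calc _ ≤ K * (4 * (1 / (4 * K) + 1 / (4 * (K : ℝ)))) := by gcongr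
    _ = 2 := by field_simp; norm_num

/-- From `log q ≤ q`, the square of the left side is at most linear in `K`, hence below `K ^ 2` for
large `K`. -/
theorem bonus_parameter_le {d H K : ℕ} {p c : ℝ} (hp : 0 < p)
    (hK : c ^ 2 * d ^ 2 * H ^ 2 * (4 * d * H / p) ≤ K) :
    c * d * H * √(Real.log (4 * d * H * K / p)) ≤ K := by
  have h1 : Real.log (4 * d * H * K / p) ≤ 4 * d * H * K / p :=
    Real.log_le_self (by positivity)
  refine abs_le_of_sq_le_sq' (?_ : _ ≤ (K : ℝ) ^ 2) (Nat.cast_nonneg K) |>.2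
  have h2 : √(Real.log (4 * d * H * K / p)) ^ 2 ≤ 4 * d * H * K / p := by
    rcases le_total 0 (Real.log (4 * d * H * K / p)) with h | h
    · rwa [Real.sq_sqrt h]
    · rw [Real.sqrt_eq_zero_of_nonpos h, sq, mul_zero]
      positivity
  calc _ = c ^ 2 * d ^ 2 * H ^ 2 * √(Real.log (4 * d * H * K / p)) ^ 2 := by ring
    _ ≤ c ^ 2 * d ^ 2 * H ^ 2 * (4 * d * H * K / p) := by gcongr
    _ = c ^ 2 * d ^ 2 * H ^ 2 * (4 * d * H / p) * K := by ring
    _ ≤ K * K := by gcongr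
    _ = (K : ℝ) ^ 2 := by ring

theorem gap_rate_le {d H K : ℕ} {c cLow z T : ℝ} (hd : 0 < d) (hK : 0 < K)
    (hcLow : 0 < cLow) (hz : 1 ≤ z) (hT : T ≤ 40 * (d * H * (√K * z))) :
    4 * H * ((T + H / √cLow) / (K * cLow / 2) + c * d * H * z / √(K * cLow / 2)) ≤
      4 * (2 / cLow * (40 + 1 / √cLow) + c / √(cLow / 2)) * d * (H : ℝ) ^ 2 *
        (K : ℝ) ^ (-(1 / 2) : ℝ) * z := by
  have hd' : (1 : ℝ) ≤ d := by exact_mod_cast hd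
  have hK' : (1 : ℝ) ≤ K := by exact_mod_cast hK
  have hK0 : (0 : ℝ) < K := by linarith
  have hrpow : (K : ℝ) ^ (-(1 / 2) : ℝ) = 1 / √K := by
    rw [Real.rpow_neg hK0.le, Real.sqrt_eq_rpow]
    exact (one_div _).symm
  have hsK : 1 ≤ √(K : ℝ) := Real.one_le_sqrt.2 hK'
  have hsc : 0 < √cLow := Real.sqrt_pos.2 hcLow
  have hKK : (K : ℝ) = √K * √K := (Real.mul_self_sqrt hK0.le).symm
  have h1 : T + H / √cLow ≤ (40 + 1 / √cLow) * (d * H * (√K * z)) := by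
    have h2 : (1 : ℝ) ≤ d * (√K * z) :=
      one_le_mul_of_one_le_of_one_le hd' (one_le_mul_of_one_le_of_one_le hsK hz)
    have h3 : H / √cLow ≤ 1 / √cLow * (d * H * (√K * z)) := by
      calc H / √cLow = 1 / √cLow * (H * 1) := by ring
        _ ≤ 1 / √cLow * (H * (d * (√K * z))) := by gcongr
        _ = _ := by ring
    linarith
  have e1 : √(K * cLow / 2) = √K * √(cLow / 2) := by
    rw [mul_div_assoc, Real.sqrt_mul hK0.le]
  have h4 : (T + H / √cLow) / (K * cLow / 2) ≤
      2 / cLow * (40 + 1 / √cLow) * (d * H * z) * (1 / √K) := by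
    refine (div_le_div_of_nonneg_right h1 (by positivity)).trans_eq ?_
    rw [show (K : ℝ) * cLow / 2 = √K * √K * cLow / 2 by rw [← hKK]]
    field_simp
  have h5 : c * d * H * z / √(K * cLow / 2) = c / √(cLow / 2) * (d * H * z) * (1 / √K) := by
    rw [e1]
    have : 0 < √(cLow / 2) := Real.sqrt_pos.2 (by positivity)
    field_simp
  rw [h5, hrpow]
  calc _ ≤ 4 * H * (2 / cLow * (40 + 1 / √cLow) * (d * H * z) * (1 / √K) +
        c / √(cLow / 2) * (d * H * z) * (1 / √K)) := by gcongr
    _ = _ := by ring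

end Rates

end OfflineMG

/-! ### The theorem -/

theorem corollary2 :
    ∃ c₀ : ℝ, 0 < c₀ ∧ ∀ c : ℝ, c₀ ≤ c → ∀ cLow : ℝ, 0 < cLow →
      ∃ c' : ℝ, 0 < c' ∧
        ∀ (d H : ℕ) (p : ℝ), 0 < d → 0 < H → 0 < p → p < 1 →
          ∃ K₀ : ℕ, ∀ K : ℕ, K₀ ≤ K → 0 < K →
            ∀ (S A B : Type*) [MeasurableSpace S]
              [Fintype A] [Nonempty A] [MeasurableSpace A] [MeasurableSingletonClass A]
              [Fintype B] [Nonempty B] [MeasurableSpace B] [MeasurableSingletonClass B]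
              (M : MarkovGame S A B H) (φ : S × A × B → EuclideanSpace ℝ (Fin d)) (x : S)
              (piBar : Policy S A) (nuBar : Policy S B),
              IsLinear M φ →
              (∀ h : Fin H, cLow ≤ lambdaMin (featureCov M φ piBar nuBar x h)) →
              episodesLaw M piBar nuBar x K
                {ω | ¬ ∀ (piHat : Policy S A) (nuHat : Policy S B),
                  IsPMVIOutput φ (c * d * H * √(Real.log (4 * d * H * K / p))) (record M ω)
                    piHat nuHat →
                  dualityGap M piHat nuHat x ≤
                    c' * d * (H : ℝ) ^ 2 * (K : ℝ) ^ (-(1 / 2) : ℝ) *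
                      √(Real.log (4 * d * H * K / p))}
                ≤ ENNReal.ofReal p := by
  -- Any positive `c₀` would do, since the bonus enters only through an upper bound. The constant
  -- `c'` is the one produced by `gap_rate_le`.
  refine ⟨1, one_pos, fun c hc cLow hcLow =>
    ⟨4 * (2 / cLow * (40 + 1 / √cLow) + c / √(cLow / 2)), by positivity,
      fun d H p hd hH hp hp1 => ?_⟩⟩
  have hd' : (1 : ℝ) ≤ d := by exact_mod_cast hd
  have hH' : (1 : ℝ) ≤ H := by exact_mod_cast hH
  set η : ℝ := cLow / (2 * d) with hη
  have hη0 : 0 < η := by positivity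
  -- The summands ensure, in order: the grid size bound, small rounding errors, `K * H ≤ K ^ 2`, `β
  -- ≤ K`, and the covariance union bound.
  refine ⟨⌈3 + 4 * (d : ℝ) + H + c ^ 2 * d ^ 2 * H ^ 2 * (4 * d * H / p) +
    32 * H * d ^ 2 / (p * η ^ 2)⌉₊, ?_⟩
  intro K hK₀ hK S A B _ _ _ _ _ _ _ _ _ M φ x piBar nuBar hM hcov
  have hsum := Nat.ceil_le.1 hK₀
  have hb1 : 0 ≤ c ^ 2 * d ^ 2 * H ^ 2 * (4 * d * H / p) := by positivity
  have hb2 : 0 ≤ 32 * H * d ^ 2 / (p * η ^ 2) := by positivity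
  have hK3 : 3 ≤ K := by
    have : (3 : ℝ) ≤ K := by linarith
    exact_mod_cast this
  have hKd : 4 * d ≤ K := by
    have : 4 * (d : ℝ) ≤ K := by linarith
    exact_mod_cast this
  have hKH : (H : ℝ) ≤ K := by linarith
  have hK' : (1 : ℝ) ≤ K := by exact_mod_cast hK
  have hζ : 1 ≤ Real.log (4 * d * H * K / p) := by
    refine (Real.le_log_iff_exp_le (by positivity)).2 ?_
    have h1 : (1 : ℝ) ≤ d * H * K := one_le_mul_of_one_le_of_one_le
      (one_le_mul_of_one_le_of_one_le hd' hH') hK'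
    rw [le_div_iff₀ hp]
    nlinarith [Real.exp_one_lt_d9, Real.exp_pos 1]
  set z := √(Real.log (4 * d * H * K / p)) with hz
  have hz1 : 1 ≤ z := Real.one_le_sqrt.2 hζ
  set β := c * d * H * z with hβ
  have hβ0 : 0 ≤ β := by positivity
  have hβK : β ≤ K := bonus_parameter_le hp (by linarith)
  obtain ⟨G, hGcard, hG⟩ := exists_grid hK3
  set t : ℝ := 15 * d * H * (√K * z) with ht
  have ht0 : 0 ≤ t := by positivity
  have hnoise := (hM.measure_exists_noise_le piBar nuBar x K G (fun σ => bif σ then β else -β)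
    ht0).trans (ENNReal.ofReal_le_ofReal (union_bound_le hd hH hK hp hp1 hGcard))
  have hcovp := (hM.measure_exists_cov_le piBar nuBar x (K := K) hη0.le).trans
    (ENNReal.ofReal_le_ofReal (cov_union_bound_le (d := d) (H := H) hp hη0 hK (by linarith)))
  have hp2 : ENNReal.ofReal p = ENNReal.ofReal (p / 2) + ENNReal.ofReal (p / 2) := by
    rw [← ENNReal.ofReal_add (by positivity) (by positivity), add_halves]
  rw [hp2]
  -- The failure event lies in the union of the two bad events; monotonicity needs no measurability
  -- of it.
  refine le_trans (measure_mono ?_) ((measure_union_le _ _).trans (add_le_add hnoise hcovp))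
  intro ω hω
  by_contra hgood
  rw [Set.mem_union, not_or] at hgood
  obtain ⟨hg1, hg2⟩ := hgood
  simp only [Set.mem_ofPred_eq, not_exists, not_and, not_le] at hg1 hg2
  refine hω fun piHat nuHat hout => ?_
  have hκ : (0 : ℝ) < K * cLow / 2 := by positivity
  have hgram := fun h => IsLinear.le_gram_of_cov hcLow hd (hcov h)
    fun i j => (hg2 h i j).le
  have hR1 : (1 : ℝ) ≤ (K : ℝ) ^ 2 := one_le_pow₀ hK'
  have hdδ : d * (1 / (K : ℝ) ^ 6) ≤ 1 / 4 := by
    have h1 : 4 * (d : ℝ) ≤ K := by linarith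
    have h2 : (K : ℝ) ≤ K ^ 6 := le_self_pow₀ hK' (by norm_num)
    rw [mul_one_div, div_le_div_iff₀ (by positivity) (by norm_num)]
    linarith
  refine (hM.dualityGap_le_of_isPMVIOutput hcLow hcov hκ hgram (R := (K : ℝ) ^ 2)
    (T := 2 * (t + K * (4 * (d * (1 / (K : ℝ) ^ 6) + β * √(d ^ 2 * (1 / (K : ℝ) ^ 6))))))
    (by positivity) hR1 (by nlinarith) hβ0 (fun σ h hh w L hw hL => ?_) hout).trans ?_
  · refine sqrt_noiseVec_le hM hR1 hG (by positivity) hdδ ?_ ht0 h hh ω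
      (fun u w L hu => (hg1 h hh σ u w L hu).le) hw hL
    cases σ <;> simp [abs_of_nonneg hβ0]
  -- The rounding term is at most `2`, so `T ≤ 2 * (t + 2)`, at most `34` times `d * H * (√K * z)`,
  -- within the allowed `40`.
  · refine gap_rate_le hd hK hcLow hz1 ?_
    have h1 := discretization_error_le hK3 hKd hβK
    have h2 : 1 ≤ d * H * (√K * z) := one_le_mul_of_one_le_of_one_le
      (one_le_mul_of_one_le_of_one_le hd' hH')
      (one_le_mul_of_one_le_of_one_le (Real.one_le_sqrt.2 hK') hz1)
    linarith
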